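/- Let $p,q$ be coprime integers with $p>0$, and choose $m,s_0\in\mathbb Z$ with $mp+s_0q=1$. Let $U=\{(re^{i\theta},e^{iz}) : 0\le r<1\}$ be the open solid torus, with core $\{r=0\}$, oriented by $dx\wedge dy\wedge dz$ where $x+iy=re^{i\theta}$. Let the lens space $L(p,q)$ be the closed oriented 3-manifold obtained from two copies $U_0,U_1$ of $U$ by identifying $(r,\theta,z)\in U_1$, $r\neq 0$, with $(1-r,\,-q\theta+mz,\,p\theta+s_0z)\in U_0$. A positive contact form is a smooth 1-form $\alpha$ with $\alpha\wedge d\alpha>0$. Its Reeb vector field $R$ is defined by $\alpha(R)=1$, $d\alpha(R,\cdot)=0$, and $\alpha$ is K-contact if $\mathcal L_Rg=0$ for some smooth Riemannian metric $g$. If $\ell$ is a periodic orbit of $R$ of minimal period $\tau$, its rotation number is the class $\phi\in\mathbb R/\mathbb Z$ such that, for $x\in\ell$, the map $e^{\tau R}_*$ of $\ker\alpha_x$, oriented by $d\alpha$, is the rotation by the angle $2\pi\phi$ in a suitable positively oriented basis; in particular its eigenvalues are $e^{\pm 2\pi i\phi}$. The form $\alpha$ is quasi-regular if all its Reeb orbits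 are periodic and irregular if at least one of them is not. Theorem. For all real $\tau_0,\tau_1>0$ there exists a positive K-contact form $\alpha$ on $L(p,q)$ admitting two distinct periodic Reeb orbits $\ell_0,\ell_1$ of minimal periods $\tau_0,\tau_1$, whose rotation numbers are, modulo $1$, $$\phi_0=\frac1p\Big(\frac{\tau_0}{\tau_1}-q\Big),\qquad \phi_1=\frac1p\Big(\frac{\tau_1}{\tau_0}-s\Big),$$ where $s$ is any integer with $sq\equiv 1 \bmod p$. Moreover, if $\tau_0/\tau_1\in\mathbb Q$ then $\alpha$ is quasi-regular, and if $\tau_0/\tau_1\notin\mathbb Q$ then $\alpha$ is irregular and $\ell_0,\ell_1$ are its only periodic Reeb orbits. -/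

import Mathlib

noncomputable section

open Set Topology
open scoped Manifold ContDiff

/-- The open solid torus `D² × S¹ ∖ ∂D² × S¹`, with points `(w, ζ) = (r e^{iθ}, e^{iz})`, `r < 1`. -/
abbrev SolidTorus : Type := {x : ℂ × Circle // ‖x.1‖ < 1}

namespace SolidTorus

instance : Nonempty SolidTorus := ⟨⟨(0, 1), by simp⟩⟩

/-- In cylindrical coordinates, the map
`(r, θ, z) ↦ (1 - r, -a θ + b z, c θ + d z)`. -/
def glue (a b c d : ℤ) (x : ℂ × Circle) : ℂ × Circle :=
  ((1 - ‖x.1‖) * ((Circle.exp x.1.arg ^ (-a) * x.2 ^ b : Circle) : ℂ),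
    Circle.exp x.1.arg ^ c * x.2 ^ d)

theorem norm_glue {a b c d : ℤ} {x : ℂ × Circle} (hx : ‖x.1‖ < 1) :
    ‖(glue a b c d x).1‖ = 1 - ‖x.1‖ := by
  have : ((1 : ℂ) - ‖x.1‖) = ((1 - ‖x.1‖ : ℝ) : ℂ) := by push_cast; rfl
  rw [glue, norm_mul, Circle.norm_coe, mul_one, this, Complex.norm_real, Real.norm_eq_abs,
    abs_of_pos (by linarith)]

theorem exp_arg_glue {a b c d : ℤ} {x : ℂ × Circle} (hx : ‖x.1‖ < 1) :
    Circle.exp (glue a b c d x).1.arg = Circle.exp x.1.arg ^ (-a) * x.2 ^ b := by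
  have : ((1 : ℂ) - ‖x.1‖) = ((1 - ‖x.1‖ : ℝ) : ℂ) := by push_cast; rfl
  rw [glue, this, Complex.arg_real_mul _ (by linarith), Circle.exp_arg]

theorem glue_ne_zero {a b c d : ℤ} {x : ℂ × Circle} (hx : ‖x.1‖ < 1) :
    (glue a b c d x).1 ≠ 0 := by
  rw [← norm_pos_iff, norm_glue hx]; linarith

theorem norm_glue_lt {a b c d : ℤ} {x : ℂ × Circle} (hx : ‖x.1‖ < 1) (h0 : x.1 ≠ 0) :
    ‖(glue a b c d x).1‖ < 1 := by
  have := norm_pos_iff.2 h0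
  rw [norm_glue hx]; linarith

theorem glue_glue {p q m s : ℤ} (h : m * p + s * q = 1) {x : ℂ × Circle} (hx : ‖x.1‖ < 1) :
    glue s m p q (glue q m p s x) = x := by
  have e1 := norm_glue (a := q) (b := m) (c := p) (d := s) hx
  have e2 := exp_arg_glue (a := q) (b := m) (c := p) (d := s) hx
  obtain ⟨w, ζ⟩ := x
  set u := Circle.exp w.arg with hu
  have e3 : (glue q m p s (w, ζ)).2 = u ^ p * ζ ^ s := rfl
  have k1 : (u ^ (-q) * ζ ^ m) ^ (-s) * (u ^ p * ζ ^ s) ^ m = u := by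
    rw [mul_zpow, mul_zpow, ← zpow_mul, ← zpow_mul, ← zpow_mul, ← zpow_mul, mul_mul_mul_comm,
      ← zpow_add, ← zpow_add, show -q * -s + p * m = 1 by linarith,
      show m * -s + s * m = 0 by ring, zpow_one, zpow_zero, mul_one]
  have k2 : (u ^ (-q) * ζ ^ m) ^ p * (u ^ p * ζ ^ s) ^ q = ζ := by
    rw [mul_zpow, mul_zpow, ← zpow_mul, ← zpow_mul, ← zpow_mul, ← zpow_mul, mul_mul_mul_comm,
      ← zpow_add, ← zpow_add, show -q * p + p * q = 0 by ring,
      show m * p + s * q = 1 by linarith, zpow_one, zpow_zero, one_mul]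
  rw [glue, e1, e2, e3]
  simp only at k1 k2 ⊢
  rw [k1, k2]
  congr 1
  rw [hu, Circle.coe_exp]
  push_cast
  rw [sub_sub_cancel, Complex.norm_mul_exp_arg_mul_I]

theorem exp_arg_eq {w : ℂ} (hw : w ≠ 0) : (Circle.exp w.arg : ℂ) = w / ‖w‖ := by
  rw [eq_div_iff (by simpa using hw), mul_comm, Circle.coe_exp, Complex.norm_mul_exp_arg_mul_I]

theorem isInducing_coe : IsInducing (fun z : Circle => (z : ℂ)) := ⟨rfl⟩

theorem continuousOn_exp_arg : ContinuousOn (fun w : ℂ => Circle.exp w.arg) {0}ᶜ := by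
  rw [isInducing_coe.continuousOn_iff]
  refine ContinuousOn.congr (f := fun w : ℂ => w / ‖w‖) ?_ fun w hw => exp_arg_eq hw
  refine continuousOn_id.div (by fun_prop) fun w hw => by simpa using hw

theorem continuousOn_glue (a b c d : ℤ) :
    ContinuousOn (glue a b c d) {x | x.1 ≠ 0} := by
  have h1 : ContinuousOn (fun x : ℂ × Circle => Circle.exp x.1.arg) {x | x.1 ≠ 0} :=
    continuousOn_exp_arg.comp continuousOn_fst fun x hx => hx
  have h2 : ContinuousOn (fun x : ℂ × Circle => x.2) {x | x.1 ≠ 0} := continuousOn_snd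
  refine ContinuousOn.prodMk ?_ ((h1.zpow c).mul (h2.zpow d))
  refine ContinuousOn.mul (by fun_prop) ?_
  exact isInducing_coe.continuous.comp_continuousOn ((h1.zpow _).mul (h2.zpow _))

end SolidTorus

/-- The transition map of the lens space leaving the `j`-th solid torus. For `j = 1` it is
`(r, θ, z) ↦ (1 - r, -q θ + m z, p θ + s z)`, and for `j = 0` it is the inverse of this map. -/
def LensSpace.transition (p q m s : ℤ) (j : Fin 2) : ℂ × Circle → ℂ × Circle :=
  if j = 1 then SolidTorus.glue q m p s else SolidTorus.glue s m p q

namespace LensSpace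

variable {p q m s : ℤ}

theorem norm_transition (j : Fin 2) {x : ℂ × Circle} (hx : ‖x.1‖ < 1) :
    ‖(transition p q m s j x).1‖ = 1 - ‖x.1‖ := by
  unfold transition; split <;> exact SolidTorus.norm_glue hx

theorem transition_ne_zero (j : Fin 2) {x : ℂ × Circle} (hx : ‖x.1‖ < 1) :
    (transition p q m s j x).1 ≠ 0 := by
  unfold transition; split <;> exact SolidTorus.glue_ne_zero hx

theorem transition_transition (h : m * p + s * q = 1) {j k : Fin 2} (hjk : j ≠ k)
    {x : ℂ × Circle} (hx : ‖x.1‖ < 1) :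
    transition p q m s k (transition p q m s j x) = x := by
  have h' : m * p + q * s = 1 := by linarith
  fin_cases j <;> fin_cases k <;> simp [transition] at hjk ⊢
  · exact SolidTorus.glue_glue h' hx
  · exact SolidTorus.glue_glue h hx

theorem continuousOn_transition (j : Fin 2) :
    ContinuousOn (transition p q m s j) {x | x.1 ≠ 0} := by
  unfold transition; split <;> exact SolidTorus.continuousOn_glue _ _ _ _

/-- Points of two copies of the solid torus are identified when they are equal or when they lie off
the cores, in different copies, and correspond to each other under the transition map. -/
def setoid (p q m s : ℤ) (h : m * p + s * q = 1) : Setoid (Fin 2 × SolidTorus) where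
  r x y := x = y ∨ (x.1 ≠ y.1 ∧ x.2.1.1 ≠ 0 ∧ y.2.1 = transition p q m s x.1 x.2.1)
  iseqv := by
    refine ⟨fun x => Or.inl rfl, ?_, ?_⟩
    · rintro x y (rfl | ⟨h1, h2, h3⟩)
      · exact Or.inl rfl
      · refine Or.inr ⟨h1.symm, ?_, ?_⟩
        · rw [h3]; exact transition_ne_zero _ x.2.2
        · rw [h3, transition_transition h h1 x.2.2]
    · rintro x y z (rfl | ⟨h1, h2, h3⟩) (rfl | ⟨h4, h5, h6⟩)
      · exact Or.inl rfl
      · exact Or.inr ⟨h4, h5, h6⟩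
      · exact Or.inr ⟨h1, h2, h3⟩
      · refine Or.inl (Prod.ext (by omega) (Subtype.ext ?_))
        rw [h6, h3, transition_transition h h1 x.2.2]

end LensSpace

/-- The lens space `L(p, q)`: two open solid tori glued along the complements of their cores by
`(r, θ, z) ↦ (1 - r, -q θ + m z, p θ + s z)`, where `m p + s q = 1`. -/
def LensSpace (p q m s : ℤ) (h : m * p + s * q = 1) : Type :=
  Quotient (LensSpace.setoid p q m s h)

namespace LensSpace

variable {p q m s : ℤ} {h : m * p + s * q = 1}

instance : TopologicalSpace (LensSpace p q m s h) :=
  inferInstanceAs (TopologicalSpace (Quotient (LensSpace.setoid p q m s h)))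

/-- The two toroidal charts `ψ₀, ψ₁ : U → L(p, q)`. -/
def ψ (h : m * p + s * q = 1) (j : Fin 2) (x : SolidTorus) : LensSpace p q m s h :=
  Quotient.mk (LensSpace.setoid p q m s h) (j, x)

theorem ψ_eq_iff {j k : Fin 2} {x y : SolidTorus} : ψ h j x = ψ h k y ↔
    (j = k ∧ x = y) ∨ (j ≠ k ∧ x.1.1 ≠ 0 ∧ y.1 = transition p q m s j x.1) := by
  refine Quotient.eq.trans ?_
  change ((j, x) = (k, y) ∨ _) ↔ _
  rw [Prod.mk.injEq]

theorem ψ_injective (j : Fin 2) : Function.Injective (ψ h j) := by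
  intro x y hxy
  simpa using ψ_eq_iff.1 hxy

theorem continuous_ψ (j : Fin 2) : Continuous (ψ h j) :=
  continuous_quotient_mk'.comp (by fun_prop)

theorem exists_ψ (x : LensSpace p q m s h) : ∃ j y, ψ h j y = x := by
  obtain ⟨⟨j, y⟩, rfl⟩ := Quotient.exists_rep x
  exact ⟨j, y, rfl⟩

theorem isOpenEmbedding_val : IsOpenEmbedding (Subtype.val : SolidTorus → ℂ × Circle) :=
  (isOpen_lt (by fun_prop) continuous_const : IsOpen {x : ℂ × Circle | ‖x.1‖ < 1}).isOpenEmbedding_subtypeVal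

theorem isOpenEmbedding_ψ (j : Fin 2) : IsOpenEmbedding (ψ h j) := by
  refine .of_continuous_injective_isOpenMap (continuous_ψ j) (ψ_injective j) fun V hV => ?_
  have hV' := isOpenEmbedding_val.isOpenMap V hV
  have hpre : ∀ k, IsOpen (ψ h k ⁻¹' (ψ h j '' V)) := by
    intro k
    by_cases hkj : k = j
    · subst hkj; rwa [preimage_image_eq _ (ψ_injective k)]
    · have : ψ h k ⁻¹' (ψ h j '' V) = Subtype.val ⁻¹' ({x : ℂ × Circle | x.1 ≠ 0} ∩
          transition p q m s k ⁻¹' (Subtype.val '' V)) := by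
        ext x
        constructor
        · rintro ⟨y, hy, hyx⟩
          obtain ⟨h1, -⟩ | ⟨-, h2, h3⟩ := ψ_eq_iff.1 hyx.symm
          · exact absurd h1 hkj
          · exact ⟨h2, y, hy, h3⟩
        · rintro ⟨h2, y, hy, h3⟩
          exact ⟨y, hy, (ψ_eq_iff.2 (Or.inr ⟨hkj, h2, h3⟩)).symm⟩
      rw [this]
      refine IsOpen.preimage isOpenEmbedding_val.continuous ?_
      exact (continuousOn_transition k).isOpen_inter_preimage
        (isOpen_compl_singleton.preimage continuous_fst) hV'
  refine isOpen_coinduced.2 ?_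
  rw [isOpen_prod_iff]
  rintro k x hx
  exact ⟨{k}, ψ h k ⁻¹' (ψ h j '' V), isOpen_discrete _, hpre k, rfl, hx, by
    rintro ⟨k', y⟩ ⟨rfl, hy⟩; exact hy⟩

/-- The inverse of the toroidal chart `ψ j`, with values in `ℂ × S¹`. -/
def toroidal (h : m * p + s * q = 1) (j : Fin 2) :
    OpenPartialHomeomorph (LensSpace p q m s h) (ℂ × Circle) :=
  ((isOpenEmbedding_ψ j).toOpenPartialHomeomorph (ψ h j)).symm.trans
    (isOpenEmbedding_val.toOpenPartialHomeomorph Subtype.val)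

theorem toroidal_source (j : Fin 2) : (toroidal h j).source = range (ψ h j) := by
  simp [toroidal]

theorem toroidal_target (j : Fin 2) : (toroidal h j).target = {x : ℂ × Circle | ‖x.1‖ < 1} := by
  simp [toroidal, SolidTorus]

theorem toroidal_ψ (j : Fin 2) (x : SolidTorus) : toroidal h j (ψ h j x) = x.1 := by
  have := ((isOpenEmbedding_ψ (h := h) j).toOpenPartialHomeomorph (ψ h j)).left_inv (x := x) (by simp)
  simp only [IsOpenEmbedding.toOpenPartialHomeomorph_apply] at this
  simp [toroidal, this]

theorem toroidal_symm (j : Fin 2) {x : ℂ × Circle} (hx : ‖x.1‖ < 1) :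
    (toroidal h j).symm x = ψ h j ⟨x, hx⟩ := by
  have := (toroidal h j).left_inv (x := ψ h j ⟨x, hx⟩) (by simp [toroidal_source])
  rwa [toroidal_ψ] at this

end LensSpace

/-- The angle coordinate on the circle minus the point opposite to `ζ₀`. -/
def SolidTorus.angleChart (ζ₀ : Circle) : OpenPartialHomeomorph Circle ℝ where
  toFun ζ := Complex.arg ζ₀ + Complex.arg (ζ / ζ₀ : Circle)
  invFun t := Circle.exp t
  source := {ζ | ((ζ / ζ₀ : Circle) : ℂ) ∈ Complex.slitPlane}
  target := Ioo (Complex.arg ζ₀ - Real.pi) (Complex.arg ζ₀ + Real.pi)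
  map_source' := by
    intro ζ hζ
    have h1 := Complex.neg_pi_lt_arg (ζ / ζ₀ : Circle)
    have h2 := lt_of_le_of_ne (Complex.arg_le_pi (ζ / ζ₀ : Circle)) (Complex.slitPlane_arg_ne_pi hζ)
    exact ⟨by linarith, by linarith⟩
  map_target' := by
    rintro t ⟨h1, h2⟩
    have : Circle.exp t / ζ₀ = Circle.exp (t - Complex.arg ζ₀) := by
      rw [Circle.exp_sub, Circle.exp_arg]
    rw [mem_ofPred_eq, this, Complex.mem_slitPlane_iff_arg,
      Circle.arg_exp (by linarith) (by linarith)]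
    exact ⟨by linarith, Circle.coe_ne_zero _⟩
  left_inv' := by
    intro ζ hζ
    rw [Circle.exp_add, Circle.exp_arg, Circle.exp_arg, mul_div_cancel]
  right_inv' := by
    rintro t ⟨h1, h2⟩
    have : Circle.exp t / ζ₀ = Circle.exp (t - Complex.arg ζ₀) := by
      rw [Circle.exp_sub, Circle.exp_arg]
    rw [this, Circle.arg_exp (by linarith) (by linarith)]; ring
  open_source := Complex.isOpen_slitPlane.preimage
    (SolidTorus.isInducing_coe.continuous.comp (continuous_id.div' continuous_const))
  open_target := isOpen_Ioo
  continuousOn_toFun := by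
    refine continuousOn_const.add (Complex.continuousOn_arg.comp ?_ fun ζ hζ => hζ)
    exact (SolidTorus.isInducing_coe.continuous.comp (continuous_id.div' continuous_const)).continuousOn
  continuousOn_invFun := Circle.exp.continuous.continuousOn

namespace LensSpace

variable {p q m s : ℤ} {h : m * p + s * q = 1}

/-- The chart with coordinates `(w, z)`, `w = r e^{iθ}`, on a part of the `j`-th solid torus on
which the angle `z` is single-valued. -/
def chart (h : m * p + s * q = 1) (j : Fin 2) (ζ₀ : Circle) :
    OpenPartialHomeomorph (LensSpace p q m s h) (ℂ × ℝ) :=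
  (toroidal h j).trans ((OpenPartialHomeomorph.refl ℂ).prod (SolidTorus.angleChart ζ₀))

theorem mem_chart_source (j : Fin 2) (y : SolidTorus) :
    ψ h j y ∈ (chart h j y.1.2).source := by
  simp [chart, toroidal_source, toroidal_ψ, SolidTorus.angleChart]

instance : ChartedSpace (ℂ × ℝ) (LensSpace p q m s h) where
  atlas := {e | ∃ j ζ₀, e = chart h j ζ₀}
  chartAt x := chart h (exists_ψ x).choose (exists_ψ x).choose_spec.choose.1.2
  mem_chart_source x := by
    have := mem_chart_source (h := h) (exists_ψ x).choose (exists_ψ x).choose_spec.choose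
    rwa [(exists_ψ x).choose_spec.choose_spec] at this
  chart_mem_atlas x := ⟨_, _, rfl⟩

end LensSpace

namespace SolidTorus

theorem contDiffAt_zpow {f : ℂ × ℝ → ℂ} {x : ℂ × ℝ} (hf : ContDiffAt ℝ ∞ f x) (h0 : f x ≠ 0)
    (n : ℤ) : ContDiffAt ℝ ∞ (fun y => f y ^ n) x := by
  cases n with
  | ofNat k => simpa using hf.pow k
  | negSucc k =>
    simp only [zpow_negSucc]
    exact (hf.pow (k + 1)).inv (pow_ne_zero _ h0)

theorem contDiffAt_exp_arg {x : ℂ × ℝ} (h0 : x.1 ≠ 0) :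
    ContDiffAt ℝ ∞ (fun y : ℂ × ℝ => (Circle.exp y.1.arg : ℂ)) x := by
  have h1 : ContDiffAt ℝ ∞ (fun y : ℂ × ℝ => y.1 / ((‖y.1‖ : ℝ) : ℂ)) x := by
    refine contDiffAt_fst.mul (ContDiffAt.inv ?_ (by simpa using h0))
    exact Complex.ofRealCLM.contDiff.contDiffAt.comp x (contDiffAt_fst.norm ℝ h0)
  refine h1.congr_of_eventuallyEq ?_
  filter_upwards [(isOpen_compl_singleton.preimage continuous_fst).mem_nhds
    (show x ∈ Prod.fst ⁻¹' {(0 : ℂ)}ᶜ from h0)] with y hy using exp_arg_eq hy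

theorem contDiffAt_circleExp {x : ℂ × ℝ} :
    ContDiffAt ℝ ∞ (fun y : ℂ × ℝ => (Circle.exp y.2 : ℂ)) x := by
  simp only [Circle.coe_exp]
  have : ContDiffAt ℝ ∞ (fun y : ℂ × ℝ => ((y.2 : ℝ) : ℂ) * Complex.I) x :=
    (Complex.ofRealCLM.contDiff.contDiffAt.comp x contDiffAt_snd).mul contDiffAt_const
  exact this.cexp

theorem contDiffAt_glue (a b c d : ℤ) {x : ℂ × ℝ} (h0 : x.1 ≠ 0) :
    ContDiffAt ℝ ∞ (fun y : ℂ × ℝ => (glue a b c d (y.1, Circle.exp y.2)).1) x ∧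
    ContDiffAt ℝ ∞ (fun y : ℂ × ℝ => ((glue a b c d (y.1, Circle.exp y.2)).2 : ℂ)) x := by
  have h1 := contDiffAt_exp_arg h0
  have h2 := contDiffAt_circleExp (x := x)
  have z1 : ∀ n : ℤ, ContDiffAt ℝ ∞ (fun y : ℂ × ℝ => (Circle.exp y.1.arg : ℂ) ^ n) x :=
    contDiffAt_zpow h1 (Circle.coe_ne_zero _)
  have z2 : ∀ n : ℤ, ContDiffAt ℝ ∞ (fun y : ℂ × ℝ => (Circle.exp y.2 : ℂ) ^ n) x :=
    contDiffAt_zpow h2 (Circle.coe_ne_zero _)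
  simp only [glue, Circle.coe_mul, Circle.coe_zpow]
  refine ⟨(contDiffAt_const.sub ?_).mul ((z1 _).mul (z2 _)), (z1 _).mul (z2 _)⟩
  exact Complex.ofRealCLM.contDiff.contDiffAt.comp x (contDiffAt_fst.norm ℝ h0)

theorem contDiffAt_angleChart (ζ₀ : Circle) {f : ℂ × ℝ → Circle} {x : ℂ × ℝ}
    (hf : ContDiffAt ℝ ∞ (fun y => (f y : ℂ)) x) (hx : f x ∈ (angleChart ζ₀).source) :
    ContDiffAt ℝ ∞ (fun y => angleChart ζ₀ (f y)) x := by
  have h1 : ContDiffAt ℝ ∞ (fun y => ((f y / ζ₀ : Circle) : ℂ)) x := by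
    have : (fun y => ((f y / ζ₀ : Circle) : ℂ)) = fun y => (f y : ℂ) * (ζ₀ : ℂ)⁻¹ := by
      funext y; rw [Circle.coe_div, div_eq_mul_inv]
    rw [this]
    exact hf.mul contDiffAt_const
  have h2 : ContDiffAt ℝ ∞ (fun y => Complex.log ((f y / ζ₀ : Circle) : ℂ)) x :=
    ContDiffAt.comp (g := Complex.log) x ((Complex.contDiffAt_log hx).restrict_scalars ℝ) h1
  have h3 : ContDiffAt ℝ ∞ (fun y => (Complex.log ((f y / ζ₀ : Circle) : ℂ)).im) x :=
    Complex.imCLM.contDiff.contDiffAt.comp x h2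
  simp only [Complex.log_im] at h3
  exact contDiffAt_const.add h3

end SolidTorus

namespace LensSpace

variable {p q m s : ℤ} {h : m * p + s * q = 1}

theorem chart_apply (j : Fin 2) (ζ₀ : Circle) (x : LensSpace p q m s h) :
    chart h j ζ₀ x = ((toroidal h j x).1, SolidTorus.angleChart ζ₀ (toroidal h j x).2) := rfl

theorem mem_chart_source_iff {j : Fin 2} {ζ₀ : Circle} {x : LensSpace p q m s h} :
    x ∈ (chart h j ζ₀).source ↔
      x ∈ range (ψ h j) ∧ (toroidal h j x).2 ∈ (SolidTorus.angleChart ζ₀).source := by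
  simp [chart, toroidal_source]

theorem chart_symm_apply {j : Fin 2} {ζ₀ : Circle} {y : ℂ × ℝ} (hy : ‖y.1‖ < 1) :
    (chart h j ζ₀).symm y = ψ h j ⟨(y.1, Circle.exp y.2), hy⟩ := by
  rw [← toroidal_symm j (x := (y.1, Circle.exp y.2)) hy, chart,
    OpenPartialHomeomorph.coe_trans_symm]
  rfl

theorem norm_lt_of_mem_chart_target {j : Fin 2} {ζ₀ : Circle} {y : ℂ × ℝ}
    (hy : y ∈ (chart h j ζ₀).target) : ‖y.1‖ < 1 := by
  have h3 := hy.2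
  rw [mem_preimage, toroidal_target] at h3
  exact h3

instance : IsManifold 𝓘(ℝ, ℂ × ℝ) ∞ (LensSpace p q m s h) := by
  refine isManifold_of_contDiffOn _ _ _ ?_
  rintro _ _ ⟨j, ζ₀, rfl⟩ ⟨k, ζ₁, rfl⟩
  rintro x ⟨hx, -⟩
  simp only [modelWithCornersSelf_coe, modelWithCornersSelf_coe_symm, Function.comp_id,
    Function.id_comp, preimage_id_eq, id_eq, range_id, inter_univ] at hx ⊢
  have key : ∀ y ∈ ((chart h j ζ₀).symm.trans (chart h k ζ₁)).source, ∃ hy : ‖y.1‖ < 1,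
      (chart h j ζ₀).symm y = ψ h j ⟨(y.1, Circle.exp y.2), hy⟩ := by
    intro y hy
    rw [OpenPartialHomeomorph.trans_source] at hy
    have h2 := norm_lt_of_mem_chart_target hy.1
    exact ⟨h2, chart_symm_apply h2⟩
  by_cases hjk : j = k
  · subst hjk
    have hc : ∀ y ∈ ((chart h j ζ₀).symm.trans (chart h j ζ₁)).source,
        ((chart h j ζ₀).symm.trans (chart h j ζ₁)) y =
          (y.1, SolidTorus.angleChart ζ₁ (Circle.exp y.2)) := by
      intro y hy
      obtain ⟨h1, h2⟩ := key y hy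
      rw [OpenPartialHomeomorph.trans_apply, h2, chart_apply, toroidal_ψ]
    refine ContDiffWithinAt.congr (ContDiffAt.contDiffWithinAt ?_) hc (hc x hx)
    refine contDiffAt_fst.prodMk
      (SolidTorus.contDiffAt_angleChart ζ₁ SolidTorus.contDiffAt_circleExp ?_)
    obtain ⟨h1, h2⟩ := key x hx
    have h3 := hx.2
    rw [OpenPartialHomeomorph.symm_symm, mem_preimage, h2, mem_chart_source_iff, toroidal_ψ] at h3
    exact h3.2
  · have hn : ∀ y ∈ ((chart h j ζ₀).symm.trans (chart h k ζ₁)).source, y.1 ≠ 0 ∧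
        toroidal h k ((chart h j ζ₀).symm y) = transition p q m s j (y.1, Circle.exp y.2) := by
      intro y hy
      obtain ⟨h1, h2⟩ := key y hy
      have h3 := hy.2
      rw [OpenPartialHomeomorph.symm_symm, mem_preimage, h2, mem_chart_source_iff] at h3
      obtain ⟨z, hz⟩ := h3.1
      obtain ⟨h5, -⟩ | ⟨-, h6, h7⟩ := ψ_eq_iff.1 hz.symm
      · exact absurd h5 hjk
      · rw [h2, ← hz, toroidal_ψ]
        exact ⟨h6, h7⟩
    have hc : ∀ y ∈ ((chart h j ζ₀).symm.trans (chart h k ζ₁)).source,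
        ((chart h j ζ₀).symm.trans (chart h k ζ₁)) y =
          ((transition p q m s j (y.1, Circle.exp y.2)).1,
            SolidTorus.angleChart ζ₁ (transition p q m s j (y.1, Circle.exp y.2)).2) := by
      intro y hy
      rw [← (hn y hy).2, OpenPartialHomeomorph.trans_apply, chart_apply]
    refine ContDiffWithinAt.congr (ContDiffAt.contDiffWithinAt ?_) hc (hc x hx)
    have h0 := (hn x hx).1
    have hs : ContDiffAt ℝ ∞ (fun y : ℂ × ℝ => (transition p q m s j (y.1, Circle.exp y.2)).1) x ∧
        ContDiffAt ℝ ∞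
          (fun y : ℂ × ℝ => ((transition p q m s j (y.1, Circle.exp y.2)).2 : ℂ)) x := by
      unfold transition
      split <;> exact SolidTorus.contDiffAt_glue _ _ _ _ h0
    refine hs.1.prodMk (SolidTorus.contDiffAt_angleChart ζ₁ hs.2 ?_)
    have h3 := hx.2
    rw [OpenPartialHomeomorph.symm_symm, mem_preimage, mem_chart_source_iff] at h3
    rw [← (hn x hx).2]
    exact h3.2

end LensSpace

namespace LensSpace

variable {p q m s : ℤ} {h : m * p + s * q = 1}

theorem ψ_mem_range {j k : Fin 2} (hjk : j ≠ k) {x : SolidTorus} (h0 : x.1.1 ≠ 0) :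
    ∃ y : SolidTorus, ψ h k y = ψ h j x ∧ ‖y.1.1‖ = 1 - ‖x.1.1‖ := by
  have h1 := norm_transition (p := p) (q := q) (m := m) (s := s) j x.2
  have h2 := norm_pos_iff.2 h0
  exact ⟨⟨transition p q m s j x.1, by linarith⟩, (ψ_eq_iff.2 (Or.inr ⟨hjk, h0, rfl⟩)).symm, h1⟩

instance : T2Space (LensSpace p q m s h) := by
  refine ⟨?_⟩
  have same : ∀ (j : Fin 2) (a b : SolidTorus), ψ h j a ≠ ψ h j b →
      ∃ u v, IsOpen u ∧ IsOpen v ∧ ψ h j a ∈ u ∧ ψ h j b ∈ v ∧ Disjoint u v := by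
    intro j a b hab
    obtain ⟨u, v, hu, hv, ha, hb, huv⟩ := t2_separation (ne_of_apply_ne (ψ h j) hab)
    exact ⟨_, _, (isOpenEmbedding_ψ j).isOpenMap u hu, (isOpenEmbedding_ψ j).isOpenMap v hv,
      mem_image_of_mem _ ha, mem_image_of_mem _ hb,
      (disjoint_image_iff (ψ_injective j)).2 huv⟩
  intro x y hxy
  obtain ⟨j, a, rfl⟩ := exists_ψ x
  obtain ⟨k, b, rfl⟩ := exists_ψ y
  by_cases hjk : j = k
  · subst hjk; exact same j a b hxy
  by_cases ha : a.1.1 = 0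
  · by_cases hb : b.1.1 = 0
    · have ho : IsOpen {c : SolidTorus | ‖c.1.1‖ < 1 / 2} :=
        isOpen_lt (by fun_prop) continuous_const
      refine ⟨_, _, (isOpenEmbedding_ψ j).isOpenMap _ ho, (isOpenEmbedding_ψ k).isOpenMap _ ho,
        mem_image_of_mem _ (by simp [ha]), mem_image_of_mem _ (by simp [hb]), ?_⟩
      rw [Set.disjoint_left]
      rintro _ ⟨c, hc, rfl⟩ ⟨d, hd, hdc⟩
      obtain ⟨h1, -⟩ | ⟨-, -, h3⟩ := ψ_eq_iff.1 hdc
      · exact hjk h1.symm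
      · have := norm_transition (p := p) (q := q) (m := m) (s := s) k d.2
        rw [← h3] at this
        simp only [mem_ofPred_eq] at hc hd
        linarith
    · obtain ⟨c, hc, -⟩ := ψ_mem_range (h := h) (Ne.symm hjk) hb
      rw [← hc] at hxy ⊢
      exact same j a c hxy
  · obtain ⟨c, hc, -⟩ := ψ_mem_range (h := h) hjk ha
    rw [← hc] at hxy ⊢
    exact same k c b hxy

instance : CompactSpace (LensSpace p q m s h) := by
  refine ⟨?_⟩
  have hK : IsCompact {c : SolidTorus | ‖c.1.1‖ ≤ 1 / 2} := by
    rw [isOpenEmbedding_val.isInducing.isCompact_iff]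
    have : Subtype.val '' {c : SolidTorus | ‖c.1.1‖ ≤ 1 / 2} =
        Metric.closedBall (0 : ℂ) (1 / 2) ×ˢ (univ : Set Circle) := by
      ext x
      constructor
      · rintro ⟨c, hc, rfl⟩
        exact ⟨by simpa using hc, mem_univ _⟩
      · rintro ⟨hx, -⟩
        have hx' : ‖x.1‖ ≤ 1 / 2 := by simpa using hx
        exact ⟨⟨x, by linarith⟩, hx', rfl⟩
    rw [this]
    exact (isCompact_closedBall _ _).prod isCompact_univ
  have : (univ : Set (LensSpace p q m s h)) = ⋃ j : Fin 2, ψ h j '' {c | ‖c.1.1‖ ≤ 1 / 2} := by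
    symm
    rw [eq_univ_iff_forall]
    intro x
    obtain ⟨j, a, rfl⟩ := exists_ψ x
    by_cases ha : ‖a.1.1‖ ≤ 1 / 2
    · exact mem_iUnion.2 ⟨j, a, ha, rfl⟩
    · have h0 : a.1.1 ≠ 0 := by rintro h0; simp [h0] at ha
      obtain ⟨c, hc, hn⟩ := ψ_mem_range (h := h) (j := j) (k := 1 - j)
        (by fin_cases j <;> simp) h0
      exact mem_iUnion.2 ⟨1 - j, c, by simp only [mem_ofPred_eq]; linarith, hc⟩
  rw [this]
  exact isCompact_iUnion fun j => hK.image (continuous_ψ j)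

end LensSpace

/-! ### Contact forms, Reeb flows and periodic orbits -/

section Contact

variable {E : Type*} [NormedAddCommGroup E] [NormedSpace ℝ E]
  {M : Type*} [TopologicalSpace M] [ChartedSpace E M]

/-- A (not necessarily smooth) differential 1-form on a manifold `M` modelled on `E`. -/
abbrev OneForm (E : Type*) [NormedAddCommGroup E] [NormedSpace ℝ E]
    (M : Type*) [TopologicalSpace M] [ChartedSpace E M] : Type _ :=
  ∀ x : M, TangentSpace 𝓘(ℝ, E) x →L[ℝ] ℝ

namespace OneForm

/-- Smoothness of a 1-form, as a section of the cotangent bundle. -/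
def IsSmooth [IsManifold 𝓘(ℝ, E) ∞ M] (α : OneForm E M) : Prop :=
  ContMDiff 𝓘(ℝ, E) (𝓘(ℝ, E).prod 𝓘(ℝ, E →L[ℝ] ℝ)) ∞
    (fun x ↦ Bundle.TotalSpace.mk' (E →L[ℝ] ℝ)
      (E := fun x : M ↦ TangentSpace 𝓘(ℝ, E) x →L[ℝ] Bundle.Trivial M ℝ x) x (α x))

/-- The coordinate expression of a 1-form: its pullback by the inverse of the chart at `x`. -/
def inChart (α : OneForm E M) (x : M) (y : E) : E →L[ℝ] ℝ :=
  (α ((chartAt E x).symm y)).comp (mfderiv 𝓘(ℝ, E) 𝓘(ℝ, E) (chartAt E x).symm y)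

/-- The exterior derivative `dα(v, w)` at `x`, computed in the chart at `x`. -/
def d (α : OneForm E M) (x : M) (v w : TangentSpace 𝓘(ℝ, E) x) : ℝ :=
  let D : TangentSpace 𝓘(ℝ, E) x →L[ℝ] E := mfderiv 𝓘(ℝ, E) 𝓘(ℝ, E) (chartAt E x) x
  let A : E → E →L[ℝ] ℝ := α.inChart x
  fderiv ℝ A (chartAt E x x) (D v) (D w) - fderiv ℝ A (chartAt E x x) (D w) (D v)

/-- The 3-form `α ∧ dα`. -/
def wedgeD (α : OneForm E M) (x : M) (u v w : TangentSpace 𝓘(ℝ, E) x) : ℝ :=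
  α x u * α.d x v w + α x v * α.d x w u + α x w * α.d x u v

/-- `R` is the Reeb vector field of `α`: `α(R) = 1` and `dα(R, ·) = 0`. -/
def IsReebField (α : OneForm E M) (R : ∀ x : M, TangentSpace 𝓘(ℝ, E) x) : Prop :=
  ∀ x, α x (R x) = 1 ∧ ∀ v, α.d x (R x) v = 0

end OneForm

/-- `Φ` is the (global, smooth) flow `t ↦ e^{tR}` of the vector field `R`. -/
structure IsFlow (R : ∀ x : M, TangentSpace 𝓘(ℝ, E) x) (Φ : ℝ → M → M) : Prop where
  contMDiff : ContMDiff (𝓘(ℝ, ℝ).prod 𝓘(ℝ, E)) 𝓘(ℝ, E) ∞ (fun z : ℝ × M ↦ Φ z.1 z.2)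
  zero : ∀ x, Φ 0 x = x
  isIntegralCurve : ∀ x, IsMIntegralCurve (fun t ↦ Φ t x) R

/-- `Φ` is the flow of the Reeb vector field of `α`. -/
def OneForm.IsReebFlow (α : OneForm E M) (Φ : ℝ → M → M) : Prop :=
  ∃ R, α.IsReebField R ∧ IsFlow R Φ

/-- The vector field with flow `Φ` is Killing for `g`: `L_R g = d/dt|_{t=0} (e^{tR})^* g = 0`. -/
def IsKillingFlow [IsManifold 𝓘(ℝ, E) ∞ M] (Φ : ℝ → M → M)
    (g : Bundle.ContMDiffRiemannianMetric 𝓘(ℝ, E) ∞ E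
      (fun x : M ↦ TangentSpace 𝓘(ℝ, E) x)) : Prop :=
  ∀ (x : M) (v w : TangentSpace 𝓘(ℝ, E) x),
    HasDerivAt (fun t : ℝ ↦ g.inner (Φ t x) (mfderiv 𝓘(ℝ, E) 𝓘(ℝ, E) (Φ t) x v)
      (mfderiv 𝓘(ℝ, E) 𝓘(ℝ, E) (Φ t) x w)) 0 0

/-- The Reeb vector field of `α` is Killing for some smooth Riemannian metric. -/
def OneForm.IsKContact [IsManifold 𝓘(ℝ, E) ∞ M] (α : OneForm E M) : Prop :=
  ∃ Φ, α.IsReebFlow Φ ∧ ∃ g, IsKillingFlow (E := E) (M := M) Φ g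

/-- The orbit of `x` under `Φ`. -/
def flowOrbit {M : Type*} (Φ : ℝ → M → M) (x : M) : Set M := range fun t ↦ Φ t x

/-- `ℓ` is a periodic orbit of `Φ` of minimal period `τ`. -/
structure IsPeriodicOrbit {M : Type*} (Φ : ℝ → M → M) (ℓ : Set M) (τ : ℝ) : Prop where
  isOrbit : ∃ x, ℓ = flowOrbit Φ x
  isLeast : ∀ x ∈ ℓ, IsLeast {t : ℝ | 0 < t ∧ Φ t x = x} τ

/-- The set of all periodic orbits of `Φ`. -/
def periodicOrbits {M : Type*} (Φ : ℝ → M → M) : Set (Set M) :=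
  {ℓ | ∃ x, ℓ = flowOrbit Φ x ∧ ∃ t : ℝ, 0 < t ∧ Φ t x = x}

/-- All orbits are periodic. -/
def IsQuasiRegular {M : Type*} (Φ : ℝ → M → M) : Prop :=
  ∀ x, flowOrbit Φ x ∈ periodicOrbits Φ

/-- At least one orbit is not periodic. -/
def IsIrregular {M : Type*} (Φ : ℝ → M → M) : Prop :=
  ∃ x, flowOrbit Φ x ∉ periodicOrbits Φ

/-- The periodic Reeb orbit `ℓ` of `α`, of minimal period `τ`, has rotation number `φ` (mod `1`):
the return map `e^{τR}_* : ξ_x → ξ_x` on the plane `ξ_x = ker α_x` is the rotation by the angle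
`2πφ` in some basis `v₁, v₂` of `ξ_x` with `dα(v₁, v₂) > 0`. Its eigenvalues are then `e^{±2πiφ}`,
and the orientation of `ξ_x` by `dα` distinguishes `φ` from `-φ`. -/
def OneForm.HasRotationNumber [IsManifold 𝓘(ℝ, E) ∞ M] (α : OneForm E M) (Φ : ℝ → M → M)
    (ℓ : Set M) (τ φ : ℝ) : Prop :=
  ∀ x ∈ ℓ, ∃ v₁ v₂ : TangentSpace 𝓘(ℝ, E) x,
    α x v₁ = 0 ∧ α x v₂ = 0 ∧ 0 < α.d x v₁ v₂ ∧
    tangentMap 𝓘(ℝ, E) 𝓘(ℝ, E) (Φ τ) ⟨x, v₁⟩ =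
      ⟨x, Real.cos (2 * Real.pi * φ) • v₁ + Real.sin (2 * Real.pi * φ) • v₂⟩ ∧
    tangentMap 𝓘(ℝ, E) 𝓘(ℝ, E) (Φ τ) ⟨x, v₂⟩ =
      ⟨x, -Real.sin (2 * Real.pi * φ) • v₁ + Real.cos (2 * Real.pi * φ) • v₂⟩

end Contact

namespace LensSpace

variable {p q m s : ℤ} {h : m * p + s * q = 1}

/-- The parametrization `(w, z) ↦ ψ_j(w, e^{iz})` of the `j`-th solid torus, for `‖w‖ < 1`. -/
def param (h : m * p + s * q = 1) (j : Fin 2) (y : ℂ × ℝ) : LensSpace p q m s h :=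
  (toroidal h j).symm (y.1, Circle.exp y.2)

/-- `α` is a positive contact form on the lens space: it is smooth and `α ∧ dα > 0` for the
orientation given by `dx ∧ dy ∧ dz` in both toroidal charts, `w = x + i y`. -/
def IsPositiveContactForm (α : OneForm (ℂ × ℝ) (LensSpace p q m s h)) : Prop :=
  α.IsSmooth ∧ ∀ (j : Fin 2) (y : ℂ × ℝ), ‖y.1‖ < 1 →
    let D : ℂ × ℝ → TangentSpace 𝓘(ℝ, ℂ × ℝ) (param h j y) :=
      mfderiv 𝓘(ℝ, ℂ × ℝ) 𝓘(ℝ, ℂ × ℝ) (param h j) y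
    0 < α.wedgeD (param h j y) (D (1, 0)) (D (Complex.I, 0)) (D (0, 1))

end LensSpace

end

noncomputable section

open Set Topology
open scoped Manifold ContDiff

/-! The Reeb field is taken linear, `a ∂θ + b ∂z`, on each solid torus. Along the core it closes up
after time `2π / b`, while the normal plane turns by the angle `2π a / b`; the prescribed periods
therefore force `b j = 2π / τ_j`. The gluing acts on the angles `(θ, z)` by an integral matrix of
determinant `-1`, and the two linear fields match exactly when `a j = (b (1 - j) - twist q s j * b
j) / p` (`angularSpeed`, `glueAffine_add`). The quotients `a j / b j` are the stated rotation
numbers modulo `1`.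

A rotation-invariant form with this Reeb field is `α = dz / b + f (dθ - (a / b) dz)` with `f =
f(r)`. Indeed `dα = f' dr ∧ (dθ - (a / b) dz)` kills the field, and `α ∧ dα = (f' / b) dr ∧ dθ ∧
dz`, so the contact condition off the core is `f' > 0`. The choice `f = c (1 - cos π r)` increases
on `(0, 1)` and is `r²` times a smooth function of `r²`, hence extends over the core with positive
`α ∧ dα` there too (`contactForm_wedge_pos`). With `c = p / (2 b (1 - j))` the forms on the two tori
correspond under `r ↦ 1 - r`, because `cos π(1 - r) = -cos π r` (`contactForm_glue`). Two flat
metrics patched by a cutoff depending on `r` alone give a metric for which the flow is isometric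
(`metric_glue`, `metric_linearFlow`).

A trajectory off the cores closes up at time `t` only if `a j * t` and `b j * t` lie in `2πℤ`. Then
`b 0 * t` and `b 1 * t` both lie in `2πℤ`, and `τ₀ / τ₁` is rational (`exists_rat_of_flow_eq`).
Conversely a rational ratio gives one period common to all points (`isQuasiRegular_flow`).

Every object on the lens space is defined at `x` by its local expression in the preferred chart at
`x`; `eq_apply_paramDeriv` for tensors and `flow_param` for the flow allow computation in either
solid torus. -/

theorem inCoordinates_apply_eq {B F₁ F₂ : Type*} [TopologicalSpace B]
    [NormedAddCommGroup F₁] [NormedSpace ℝ F₁] [NormedAddCommGroup F₂] [NormedSpace ℝ F₂]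
    {E₁ E₂ : B → Type*} [∀ x, AddCommGroup (E₁ x)] [∀ x, Module ℝ (E₁ x)]
    [∀ x, AddCommGroup (E₂ x)] [∀ x, Module ℝ (E₂ x)]
    [∀ x, TopologicalSpace (E₁ x)] [∀ x, TopologicalSpace (E₂ x)]
    [TopologicalSpace (Bundle.TotalSpace F₁ E₁)] [TopologicalSpace (Bundle.TotalSpace F₂ E₂)]
    [FiberBundle F₁ E₁] [VectorBundle ℝ F₁ E₁] [FiberBundle F₂ E₂] [VectorBundle ℝ F₂ E₂]
    {x₀ x : B} {ϕ : E₁ x →L[ℝ] E₂ x} {v : F₁} (h₁ : x ∈ (trivializationAt F₁ E₁ x₀).baseSet)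
    (h₂ : x ∈ (trivializationAt F₂ E₂ x₀).baseSet) :
    ContinuousLinearMap.inCoordinates F₁ E₁ F₂ E₂ x₀ x x₀ x ϕ v =
      (trivializationAt F₂ E₂ x₀).linearMapAt ℝ x
        (ϕ ((trivializationAt F₁ E₁ x₀).symm x v)) := by
  rw [ContinuousLinearMap.inCoordinates_eq h₁ h₂]
  simp [h₂]

/-! ### Tensor fields on a manifold through the preferred charts -/

section Manifold

variable {E : Type*} [NormedAddCommGroup E] [NormedSpace ℝ E]
  {M : Type*} [TopologicalSpace M] [ChartedSpace E M]

theorem symmL_trivializationAt_eq [IsManifold 𝓘(ℝ, E) ∞ M] {x₀ x : M}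
    (hx : x ∈ (chartAt E x₀).source) :
    (trivializationAt E (TangentSpace 𝓘(ℝ, E)) x₀).symmL ℝ x =
      mfderiv 𝓘(ℝ, E) 𝓘(ℝ, E) (chartAt E x₀).symm (chartAt E x₀ x) := by
  have : IsManifold 𝓘(ℝ, E) 1 M := IsManifold.of_le (n := ∞) (by simp)
  rw [TangentBundle.symmL_trivializationAt hx]
  simp [mfderivWithin_univ]
  rfl

theorem symm_trivializationAt_eq [IsManifold 𝓘(ℝ, E) ∞ M] {x₀ x : M}
    (hx : x ∈ (chartAt E x₀).source) (v : E) :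
    (trivializationAt E (TangentSpace 𝓘(ℝ, E)) x₀).symm x v =
      (mfderiv 𝓘(ℝ, E) 𝓘(ℝ, E) (chartAt E x₀).symm (chartAt E x₀ x) : E →L[ℝ] E) v :=
  ((trivializationAt E (TangentSpace 𝓘(ℝ, E)) x₀).symmL_apply (R := ℝ) hx v).symm.trans
    (DFunLike.congr_fun (symmL_trivializationAt_eq hx) v)

/-- The tangent space at `x` is the model space read through the preferred chart at `x`. This is why
forms, metrics and vector fields can later be prescribed at `x` directly as data on `ℂ × ℝ`. -/
theorem mfderiv_chartAt_self (x : M) [IsManifold 𝓘(ℝ, E) ∞ M] :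
    mfderiv 𝓘(ℝ, E) 𝓘(ℝ, E) (chartAt E x) x = ContinuousLinearMap.id ℝ E := by
  have : IsManifold 𝓘(ℝ, E) 1 M := IsManifold.of_le (n := ∞) (by simp)
  have := mfderiv_extChartAt_self (I := 𝓘(ℝ, E)) (x := x)
  simp only [mfld_simps] at this
  exact this

theorem mdifferentiableAt_chartAt_symm [IsManifold 𝓘(ℝ, E) ∞ M] (x : M) {y : E}
    (hy : y ∈ (chartAt E x).target) :
    MDifferentiableAt 𝓘(ℝ, E) 𝓘(ℝ, E) (chartAt E x).symm y :=
  have : IsManifold 𝓘(ℝ, E) 1 M := IsManifold.of_le (n := ∞) (by simp)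
  mdifferentiableAt_atlas_symm (chart_mem_atlas _ _) hy

theorem mdifferentiableAt_chartAt [IsManifold 𝓘(ℝ, E) ∞ M] (x : M) {y : M}
    (hy : y ∈ (chartAt E x).source) :
    MDifferentiableAt 𝓘(ℝ, E) 𝓘(ℝ, E) (chartAt E x) y :=
  have : IsManifold 𝓘(ℝ, E) 1 M := IsManifold.of_le (n := ∞) (by simp)
  mdifferentiableAt_atlas (chart_mem_atlas _ _) hy

theorem contMDiffAt_chartAt_self [IsManifold 𝓘(ℝ, E) ∞ M] (x : M) :
    ContMDiffAt 𝓘(ℝ, E) 𝓘(ℝ, E) ∞ (chartAt E x) x :=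
  (contMDiffOn_chart (I := 𝓘(ℝ, E)) (n := ∞) (x := x)).contMDiffAt
    ((chartAt E x).open_source.mem_nhds (mem_chart_source E x))

theorem mfderiv_chartAt_symm_self (x : M) [IsManifold 𝓘(ℝ, E) ∞ M] :
    mfderiv 𝓘(ℝ, E) 𝓘(ℝ, E) (chartAt E x).symm (chartAt E x x) = ContinuousLinearMap.id ℝ E := by
  have h1 := mfderiv_comp_of_eq (I := 𝓘(ℝ, E)) (I' := 𝓘(ℝ, E)) (I'' := 𝓘(ℝ, E))
    (x := chartAt E x x) (f := (chartAt E x).symm) (g := chartAt E x) (y := x)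
    (mdifferentiableAt_chartAt x (mem_chart_source E x))
    (mdifferentiableAt_chartAt_symm x (mem_chart_target E x))
    ((chartAt E x).left_inv (mem_chart_source E x))
  have h2 : (chartAt E x ∘ (chartAt E x).symm) =ᶠ[𝓝 (chartAt E x x)] id := by
    filter_upwards [(chartAt E x).open_target.mem_nhds (mem_chart_target E x)] with y hy
    exact (chartAt E x).right_inv hy
  rw [h2.mfderiv_eq, mfderiv_id, (chartAt E x).left_inv (mem_chart_source E x),
    mfderiv_chartAt_self] at h1
  exact h1.symm

/-- All tangent spaces are definitionally `E`, so a vector can stay fixed while the base point is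
rewritten. This avoids transports between fibres. -/
theorem OneForm.congr_point (α : OneForm E M) {x x' : M} (hx : x = x') (v : E) :
    α x v = α x' v := by
  subst hx; rfl

theorem congr_point_bilinear
    (g : ∀ x : M, TangentSpace 𝓘(ℝ, E) x →L[ℝ] TangentSpace 𝓘(ℝ, E) x →L[ℝ] ℝ) {x x' : M}
    (hx : x = x') (v w : E) : g x v w = g x' v w := by
  subst hx; rfl

theorem OneForm.d_eq [IsManifold 𝓘(ℝ, E) ∞ M] (α : OneForm E M) (x : M)
    (v w : TangentSpace 𝓘(ℝ, E) x) : α.d x v w = fderiv ℝ (α.inChart x) (chartAt E x x) v w -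
      fderiv ℝ (α.inChart x) (chartAt E x x) w v := by
  unfold OneForm.d
  rw [mfderiv_chartAt_self]
  rfl

theorem linearMapAt_trivial (x x' : M) (c : ℝ) :
    (trivializationAt ℝ (Bundle.Trivial M ℝ) x).linearMapAt ℝ x' c = c :=
  DFunLike.congr_fun (Bundle.Trivial.linearMapAt_trivialization ℝ M ℝ x') c

/-- A 1-form is smooth if its coordinate expressions are. -/
theorem OneForm.isSmooth_of_inChart [IsManifold 𝓘(ℝ, E) ∞ M] (α : OneForm E M)
    (hα : ∀ x, ContDiffAt ℝ ∞ (α.inChart x) (chartAt E x x)) : α.IsSmooth := by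
  intro x
  rw [contMDiffAt_hom_bundle]
  refine ⟨contMDiffAt_id, ?_⟩
  have h1 : ContMDiffAt 𝓘(ℝ, E) 𝓘(ℝ, E →L[ℝ] ℝ) ∞ (fun x' => α.inChart x (chartAt E x x')) x :=
    (hα x).contMDiffAt.comp x (contMDiffAt_chartAt_self x)
  refine h1.congr_of_eventuallyEq ?_
  filter_upwards [(chartAt E x).open_source.mem_nhds (mem_chart_source E x)] with x' hx'
  ext v
  have h2 := inCoordinates_apply_eq (F₁ := E) (F₂ := ℝ) (E₁ := fun x : M ↦ TangentSpace 𝓘(ℝ, E) x)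
    (E₂ := Bundle.Trivial M ℝ) (x₀ := x) (x := x') (ϕ := α x') (v := v) hx' (mem_univ _)
  refine h2.trans ((linearMapAt_trivial x x' _).trans ?_)
  refine (congrArg (fun u : E => α x' u) (symm_trivializationAt_eq hx' v)).trans ?_
  exact (α.congr_point ((chartAt E x).left_inv hx') _).symm

/-- A field of bilinear forms is smooth if its coordinate expressions are. -/
theorem contMDiff_bilinear_of_chart [IsManifold 𝓘(ℝ, E) ∞ M]
    (g : ∀ x : M, TangentSpace 𝓘(ℝ, E) x →L[ℝ] TangentSpace 𝓘(ℝ, E) x →L[ℝ] ℝ)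
    (G : M → E → E →L[ℝ] E →L[ℝ] ℝ) (hG : ∀ x, ContDiffAt ℝ ∞ (G x) (chartAt E x x))
    (hg : ∀ x, ∀ y ∈ (chartAt E x).target, ∀ v w : E,
      g ((chartAt E x).symm y) (mfderiv 𝓘(ℝ, E) 𝓘(ℝ, E) (chartAt E x).symm y v)
        (mfderiv 𝓘(ℝ, E) 𝓘(ℝ, E) (chartAt E x).symm y w) = G x y v w) :
    ContMDiff 𝓘(ℝ, E) (𝓘(ℝ, E).prod 𝓘(ℝ, E →L[ℝ] E →L[ℝ] ℝ)) ∞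
      (fun x ↦ Bundle.TotalSpace.mk' (E →L[ℝ] E →L[ℝ] ℝ)
        (E := fun x : M ↦ TangentSpace 𝓘(ℝ, E) x →L[ℝ] TangentSpace 𝓘(ℝ, E) x →L[ℝ] ℝ)
        x (g x)) := by
  intro x
  rw [contMDiffAt_hom_bundle]
  refine ⟨contMDiffAt_id, ?_⟩
  have h1 : ContMDiffAt 𝓘(ℝ, E) 𝓘(ℝ, E →L[ℝ] E →L[ℝ] ℝ) ∞ (fun x' => G x (chartAt E x x')) x :=
    (hG x).contMDiffAt.comp x (contMDiffAt_chartAt_self x)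
  refine h1.congr_of_eventuallyEq ?_
  filter_upwards [(chartAt E x).open_source.mem_nhds (mem_chart_source E x)] with x' hx'
  ext v w
  have h2 := inCoordinates_apply_eq₂ (F₁ := E) (F₂ := E) (F₃ := ℝ)
    (E₁ := fun x : M ↦ TangentSpace 𝓘(ℝ, E) x) (E₂ := fun x : M ↦ TangentSpace 𝓘(ℝ, E) x)
    (E₃ := Bundle.Trivial M ℝ) (𝕜 := ℝ) (x₀ := x) (x := x') (ϕ := g x') (v := v) (w := w)
    hx' hx' (mem_univ _)
  refine h2.trans ?_
  refine (linearMapAt_trivial x x' _).trans ?_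
  have h5 := hg x _ ((chartAt E x).map_source hx') v w
  rw [← h5]
  refine (congrArg₂ (fun u u' : E => g x' u u') 
    (symm_trivializationAt_eq hx' v) (symm_trivializationAt_eq hx' w)).trans ?_
  exact (congr_point_bilinear g ((chartAt E x).left_inv hx') _ _).symm

/-- Near `y` the map `φ` factors through the chart at `x` and its inverse; the chain rule does the
rest. -/
theorem inChart_comp_fderiv [IsManifold 𝓘(ℝ, E) ∞ M] (α : OneForm E M) {φ : E → M} {x : M} {y : E}
    (hφ : MDifferentiableAt 𝓘(ℝ, E) 𝓘(ℝ, E) φ y) (hc : ContinuousAt φ y)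
    (hy : φ y ∈ (chartAt E x).source) (v : E) :
    α.inChart x (chartAt E x (φ y)) (fderiv ℝ (chartAt E x ∘ φ) y v) =
      α (φ y) (mfderiv 𝓘(ℝ, E) 𝓘(ℝ, E) φ y v) := by
  have h1 : MDifferentiableAt 𝓘(ℝ, E) 𝓘(ℝ, E) (chartAt E x ∘ φ) y :=
    (mdifferentiableAt_chartAt x hy).comp y hφ
  have h2 : φ =ᶠ[𝓝 y] (chartAt E x).symm ∘ (chartAt E x ∘ φ) := by
    filter_upwards [hc.preimage_mem_nhds ((chartAt E x).open_source.mem_nhds hy)] with y' hy'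
    exact ((chartAt E x).left_inv hy').symm
  have h3 : mfderiv 𝓘(ℝ, E) 𝓘(ℝ, E) φ y v = (mfderiv 𝓘(ℝ, E) 𝓘(ℝ, E) (chartAt E x).symm
      (chartAt E x (φ y)) : E →L[ℝ] E) (fderiv ℝ (chartAt E x ∘ φ) y v) := by
    have h4 := mfderiv_comp y (mdifferentiableAt_chartAt_symm x
      ((chartAt E x).map_source hy)) h1
    rw [h2.mfderiv_eq, h4, ← mfderiv_eq_fderiv]
    rfl
  rw [h3]
  exact α.congr_point ((chartAt E x).left_inv hy) _

/-- The exterior derivative of a 1-form commutes with pullback. -/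
theorem OneForm.d_mfderiv [IsManifold 𝓘(ℝ, E) ∞ M] (α : OneForm E M) {φ : E → M} {y : E}
    (hφ : ∀ᶠ y' in 𝓝 y, ContMDiffAt 𝓘(ℝ, E) 𝓘(ℝ, E) ∞ φ y')
    (hα : DifferentiableAt ℝ (α.inChart (φ y)) (chartAt E (φ y) (φ y)))
    {B : E → E →L[ℝ] ℝ}
    (hB : ∀ᶠ y' in 𝓝 y, ∀ v, B y' v = α (φ y') (mfderiv 𝓘(ℝ, E) 𝓘(ℝ, E) φ y' v)) (v w : E) :
    α.d (φ y) (mfderiv 𝓘(ℝ, E) 𝓘(ℝ, E) φ y v) (mfderiv 𝓘(ℝ, E) 𝓘(ℝ, E) φ y w) =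
      fderiv ℝ B y v w - fderiv ℝ B y w v := by
  set x := φ y with hx
  set T : E → E := chartAt E x ∘ φ with hT
  have hφy := hφ.self_of_nhds
  have hTs : ContDiffAt ℝ ∞ T y := by
    rw [← contMDiffAt_iff_contDiffAt]
    exact (contMDiffAt_chartAt_self x).comp y hφy
  have hD : ∀ v, mfderiv 𝓘(ℝ, E) 𝓘(ℝ, E) φ y v = fderiv ℝ T y v := by
    intro v
    have h4 := mfderiv_comp y (mdifferentiableAt_chartAt x (mem_chart_source E x))
      (hφy.mdifferentiableAt (by simp))
    rw [← mfderiv_eq_fderiv, hT, h4, mfderiv_chartAt_self]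
    rfl
  have hBA : B =ᶠ[𝓝 y] fun y' => (α.inChart x (T y')).comp (fderiv ℝ T y') := by
    filter_upwards [hφ, hB, hφy.continuousAt.preimage_mem_nhds
      ((chartAt E x).open_source.mem_nhds (mem_chart_source E x))] with y' h1 h2 h3
    ext v
    rw [h2]
    exact (inChart_comp_fderiv α (h1.mdifferentiableAt (by simp)) h1.continuousAt h3 v).symm
  have hT1 : HasFDerivAt T (fderiv ℝ T y) y := (hTs.differentiableAt (by simp)).hasFDerivAt
  have hT2 : HasFDerivAt (fderiv ℝ T) (fderiv ℝ (fderiv ℝ T) y) y :=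
    ((hTs.fderiv_right (m := 1) (by norm_cast)).differentiableAt (by simp)).hasFDerivAt
  -- Differentiating the pullback produces a second derivative of the coordinate change `T`. It is
  -- symmetric, so it drops out of the antisymmetrized expression.
  have hsymm : IsSymmSndFDerivAt ℝ T y :=
    hTs.isSymmSndFDerivAt (by simp only [minSmoothness_of_isRCLikeNormedField]; norm_cast)
  have h6 := ((hα.hasFDerivAt.comp y hT1).clm_comp hT2)
  have h7 := (h6.congr_of_eventuallyEq hBA).fderiv
  have h8 : α.d x (mfderiv 𝓘(ℝ, E) 𝓘(ℝ, E) φ y v) (mfderiv 𝓘(ℝ, E) 𝓘(ℝ, E) φ y w) =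
      fderiv ℝ (α.inChart x) (chartAt E x x) (fderiv ℝ T y v) (fderiv ℝ T y w) -
      fderiv ℝ (α.inChart x) (chartAt E x x) (fderiv ℝ T y w) (fderiv ℝ T y v) := by
    refine (α.d_eq x _ _).trans ?_
    exact congrArg₂ (fun a b : E => fderiv ℝ (α.inChart x) (chartAt E x x) a b -
      fderiv ℝ (α.inChart x) (chartAt E x x) b a) (hD v) (hD w)
  rw [h8, h7]
  have h9 := hsymm v w
  simp [h9]

/-- A positive definite bilinear form on a finite-dimensional space has bounded unit ball. -/
theorem isVonNBounded_of_posDef [FiniteDimensional ℝ E] (B : E →L[ℝ] E →L[ℝ] ℝ)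
    (hB : ∀ v, v ≠ 0 → 0 < B v v) : Bornology.IsVonNBounded ℝ {v : E | B v v < 1} := by
  have : ProperSpace E := FiniteDimensional.proper ℝ E
  rw [NormedSpace.isVonNBounded_iff]
  have hc : Continuous fun v => B v v := by fun_prop
  -- The minimum of `B` on the unit sphere bounds `‖v‖`; an empty sphere means that the space is
  -- trivial.
  obtain hE | ⟨e, he⟩ := (Metric.sphere (0 : E) 1).eq_empty_or_nonempty
  · have : ∀ v : E, v = 0 := by
      intro v
      by_contra hv
      have : ‖v‖⁻¹ • v ∈ Metric.sphere (0 : E) 1 := by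
        simp [norm_smul, inv_mul_cancel₀ (norm_ne_zero_iff.2 hv)]
      rw [hE] at this
      exact this
    exact (Bornology.isBounded_singleton (x := (0 : E))).subset fun v _ => this v
  obtain ⟨u, hu, hmin⟩ := (isCompact_sphere (0 : E) 1).exists_isMinOn ⟨e, he⟩ hc.continuousOn
  have hu0 : 0 < B u u := hB u (by rintro rfl; simp at hu)
  rw [isBounded_iff_forall_norm_le]
  refine ⟨Real.sqrt (1 / B u u), fun v hv => ?_⟩
  rcases eq_or_ne v 0 with rfl | hv0
  · simp
  have h1 : ‖v‖⁻¹ • v ∈ Metric.sphere (0 : E) 1 := by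
    simp [norm_smul, inv_mul_cancel₀ (norm_ne_zero_iff.2 hv0)]
  have h2 : B u u ≤ B (‖v‖⁻¹ • v) (‖v‖⁻¹ • v) := hmin h1
  have hn : 0 < ‖v‖ := norm_pos_iff.2 hv0
  simp only [map_smul, smul_apply, smul_eq_mul] at h2
  refine Real.le_sqrt_of_sq_le ?_
  rw [le_div_iff₀ hu0]
  have h3 : B v v < 1 := hv
  calc ‖v‖ ^ 2 * B u u ≤ ‖v‖ ^ 2 * (‖v‖⁻¹ * (‖v‖⁻¹ * B v v)) := by gcongr
    _ = B v v := by field_simp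
    _ ≤ 1 := h3.le

end Manifold

/-! ### The smooth function behind `1 - cos π r` -/

/-- The entire function `t ↦ (1 - cos √t) / t`. -/
def cosRem : ℝ → ℝ :=
  FormalMultilinearSeries.ofScalarsSum (fun n : ℕ => (-1 : ℝ) ^ n / (2 * n + 2).factorial)

/-- Ratio test: consecutive coefficients have quotient `1 / ((2n + 3)(2n + 4))` in absolute value,
which is at most `1 / (n + 1)`. -/
theorem radius_cosRem_series : (FormalMultilinearSeries.ofScalars ℝ
    (fun n : ℕ => (-1 : ℝ) ^ n / (2 * n + 2).factorial)).radius = ⊤ := by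
  refine FormalMultilinearSeries.ofScalars_radius_eq_top_of_tendsto _ _
    (Filter.Eventually.of_forall fun n => by positivity) ?_
  refine squeeze_zero (fun n => by positivity) (fun n => ?_) tendsto_one_div_add_atTop_nhds_zero_nat
  rw [show 2 * n.succ + 2 = (2 * n + 2) + 1 + 1 by lia, Nat.factorial_succ (2 * n + 2 + 1),
    Nat.factorial_succ (2 * n + 2)]
  have hf : (0 : ℝ) < (2 * n + 2).factorial := by positivity
  simp only [norm_div, norm_pow, norm_neg, norm_one, one_pow]
  push_cast
  rw [Real.norm_of_nonneg (by positivity), Real.norm_of_nonneg (by positivity),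
    div_div_eq_mul_div, div_one, div_mul_eq_mul_div, one_mul,
    div_le_div_iff₀ (by positivity) (by positivity)]
  nlinarith [mul_nonneg hf.le (Nat.cast_nonneg n : (0 : ℝ) ≤ n),
    mul_nonneg (mul_nonneg hf.le (Nat.cast_nonneg n : (0 : ℝ) ≤ n))
      (Nat.cast_nonneg n : (0 : ℝ) ≤ n)]

theorem contDiff_cosRem : ContDiff ℝ ∞ cosRem := by
  have h := (FormalMultilinearSeries.ofScalars ℝ
    (fun n : ℕ => (-1 : ℝ) ^ n / (2 * n + 2).factorial)).hasFPowerSeriesOnBall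
    (by rw [radius_cosRem_series]; exact ENNReal.zero_lt_top)
  have h2 : AnalyticOnNhd ℝ cosRem univ := by
    have := h.analyticOnNhd
    rw [radius_cosRem_series] at this
    intro x _
    exact this x (by simp)
  rw [← contDiffOn_univ]
  exact h2.contDiffOn uniqueDiffOn_univ

theorem sq_mul_cosRem (x : ℝ) : x ^ 2 * cosRem (x ^ 2) = 1 - Real.cos x := by
  have h1 := (hasSum_nat_add_iff' 1).2 (Real.hasSum_cos x)
  have h2 := h1.neg
  simp only [Finset.range_one, Finset.sum_singleton] at h2
  rw [cosRem, FormalMultilinearSeries.ofScalarsSum_eq_tsum, ← tsum_mul_left]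
  rw [show 1 - Real.cos x = -(Real.cos x - (-1) ^ 0 * x ^ (2 * 0) / ((2 * 0).factorial : ℕ)) by
    simp, ← h2.tsum_eq]
  refine tsum_congr fun n => ?_
  rw [show 2 * (n + 1) = 2 * n + 2 by ring]
  simp only [smul_eq_mul]
  ring

theorem cosRem_zero : cosRem 0 = 1 / 2 := by
  rw [cosRem, FormalMultilinearSeries.ofScalarsSum_zero]
  simp

/-- The quantity is the derivative of `t * cosRem t`. Substituting `t = x²` turns this product into
`1 - cos x`, whose derivative `sin x` is positive on `(0, π)`; the factor `2x` of the chain rule is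
divided out. At `t = 0` the value is `1 / 2`. -/
theorem cosRem_add_mul_deriv_pos {t : ℝ} (h0 : 0 ≤ t) (ht : t < Real.pi ^ 2) :
    0 < cosRem t + t * deriv cosRem t := by
  rcases h0.eq_or_lt with rfl | h0
  · simp [cosRem_zero]
  set x := √t with hx
  have hx0 : 0 < x := Real.sqrt_pos.2 h0
  have hxt : x ^ 2 = t := Real.sq_sqrt h0.le
  have hxpi : x < Real.pi := by
    rw [hx, Real.sqrt_lt' Real.pi_pos]; exact ht
  have hd : HasDerivAt cosRem (deriv cosRem (x ^ 2)) (x ^ 2) :=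
    (contDiff_cosRem.differentiable (by simp) _).hasDerivAt
  have h1 : HasDerivAt (fun x : ℝ => x ^ 2 * cosRem (x ^ 2))
      (2 * x * cosRem (x ^ 2) + x ^ 2 * (deriv cosRem (x ^ 2) * (2 * x))) x := by
    have h3 : HasDerivAt (fun x : ℝ => x ^ 2) (2 * x) x := by simpa using hasDerivAt_pow 2 x
    have h4 : HasDerivAt (fun x : ℝ => cosRem (x ^ 2)) (deriv cosRem (x ^ 2) * (2 * x)) x :=
      HasDerivAt.comp (h₂ := cosRem) (h := fun x : ℝ => x ^ 2) x hd h3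
    exact h3.mul h4
  have h2 : HasDerivAt (fun x : ℝ => x ^ 2 * cosRem (x ^ 2)) (Real.sin x) x := by
    simp only [sq_mul_cosRem]
    simpa using (Real.hasDerivAt_cos x).const_sub 1
  have h3 := h1.unique h2
  have h4 := Real.sin_pos_of_pos_of_lt_pi hx0 hxpi
  rw [← h3, hxt] at h4
  have h5 : 0 < (2 * x) * (cosRem t + t * deriv cosRem t) := by linarith
  exact pos_of_mul_pos_right h5 (by positivity)

/-! ### The contact form on a solid torus -/

namespace SolidTorus

/-- The coordinate `x`, where `w = x + i y`. -/
def dx : ℂ × ℝ →L[ℝ] ℝ := Complex.reCLM.comp (ContinuousLinearMap.fst ℝ ℂ ℝ)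

/-- The coordinate `y`, where `w = x + i y`. -/
def dy : ℂ × ℝ →L[ℝ] ℝ := Complex.imCLM.comp (ContinuousLinearMap.fst ℝ ℂ ℝ)

/-- The coordinate `z`. -/
def dz : ℂ × ℝ →L[ℝ] ℝ := ContinuousLinearMap.snd ℝ ℂ ℝ

@[simp] theorem dx_apply (v : ℂ × ℝ) : dx v = v.1.re := rfl
@[simp] theorem dy_apply (v : ℂ × ℝ) : dy v = v.1.im := rfl
@[simp] theorem dz_apply (v : ℂ × ℝ) : dz v = v.2 := rfl

/-- The function `r² = x² + y²`. -/
def rsq (y : ℂ × ℝ) : ℝ := dx y ^ 2 + dy y ^ 2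

/-- The 1-form `r dr = x dx + y dy`. -/
def rdr (y : ℂ × ℝ) : ℂ × ℝ →L[ℝ] ℝ := dx y • dx + dy y • dy

/-- The 1-form `r² dθ = x dy - y dx`. -/
def rsqdθ (y : ℂ × ℝ) : ℂ × ℝ →L[ℝ] ℝ := dx y • dy - dy y • dx

theorem rsq_eq (y : ℂ × ℝ) : rsq y = ‖y.1‖ ^ 2 := by
  rw [Complex.sq_norm, Complex.normSq_apply, rsq, dx_apply, dy_apply]; ring

theorem rdr_apply (y v : ℂ × ℝ) : rdr y v = y.1.re * v.1.re + y.1.im * v.1.im := rfl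

theorem rsqdθ_apply (y v : ℂ × ℝ) : rsqdθ y v = y.1.re * v.1.im - y.1.im * v.1.re := rfl

/-- The 1-form `f dθ + (1 - a f) / b dz`, with `f = c (1 - cos (π r))`. It takes the value `1` on
the vector field `a ∂θ + b ∂z`. -/
def contactForm (a b c : ℝ) (y : ℂ × ℝ) : ℂ × ℝ →L[ℝ] ℝ :=
  b⁻¹ • dz + (c * Real.pi ^ 2 * cosRem (Real.pi ^ 2 * rsq y)) •
    (rsqdθ y - (a / b * rsq y) • dz)

theorem contDiff_contactForm (a b c : ℝ) : ContDiff ℝ ∞ (contactForm a b c) := by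
  have h := contDiff_cosRem
  unfold contactForm rsqdθ rsq
  fun_prop

theorem hasFDerivAt_rsq (y : ℂ × ℝ) : HasFDerivAt rsq ((2 : ℝ) • rdr y) y := by
  have h1 := (dx.hasFDerivAt (x := y)).pow 2
  have h2 := (dy.hasFDerivAt (x := y)).pow 2
  refine (h1.add h2).congr_fderiv ?_
  ext v <;> simp [rdr]
  ring

theorem fderiv_contactForm (a b c : ℝ) (y u v : ℂ × ℝ) :
    fderiv ℝ (contactForm a b c) y u v =
      c * Real.pi ^ 2 * (Real.pi ^ 2 * deriv cosRem (Real.pi ^ 2 * rsq y) * (2 * rdr y u) *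
        (rsqdθ y v - a / b * rsq y * v.2) +
      cosRem (Real.pi ^ 2 * rsq y) * (rsqdθ u v - a / b * (2 * rdr y u) * v.2)) := by
  have hr := hasFDerivAt_rsq y
  have hd : HasDerivAt cosRem (deriv cosRem (Real.pi ^ 2 * rsq y)) (Real.pi ^ 2 * rsq y) :=
    (contDiff_cosRem.differentiable (by simp) _).hasDerivAt
  have h1 := (hd.comp_hasFDerivAt y (hr.const_mul (Real.pi ^ 2))).const_mul (c * Real.pi ^ 2)
  have h2 : HasFDerivAt (fun y => contactForm a b c y v) _ y :=
    (h1.mul ((((dx.hasFDerivAt (x := y)).mul_const v.1.im).sub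
      ((dy.hasFDerivAt (x := y)).mul_const v.1.re)).sub
        ((hr.const_mul (a / b)).mul_const v.2))).const_add (b⁻¹ * v.2)
  have h3 := ((contDiff_contactForm a b c).differentiable (by simp) y).hasFDerivAt
  have h4 : HasFDerivAt (fun y => contactForm a b c y v) _ y :=
    (ContinuousLinearMap.apply ℝ ℝ v).hasFDerivAt.comp y h3
  have h5 := DFunLike.congr_fun (h4.unique h2) u
  simp only [ContinuousLinearMap.comp_apply, ContinuousLinearMap.apply_apply] at h5
  rw [h5]
  simp [rdr_apply, rsqdθ_apply]
  ring

/-- The exterior derivative of `contactForm`. -/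
def contactFormD (a b c : ℝ) (y u v : ℂ × ℝ) : ℝ :=
  fderiv ℝ (contactForm a b c) y u v - fderiv ℝ (contactForm a b c) y v u

/-- The vector field `a ∂θ + b ∂z`. -/
def linearField (a b : ℝ) (y : ℂ × ℝ) : ℂ × ℝ := (a * Complex.I * y.1, b)

theorem contactForm_linearField {a b c : ℝ} (hb : b ≠ 0) (y : ℂ × ℝ) :
    contactForm a b c y (linearField a b y) = 1 := by
  simp [contactForm, linearField, rsqdθ_apply, rsq]
  field_simp
  ring

/-- Only `f (dθ - (a / b) dz)` contributes to the exterior derivative, and both `dr` and `dθ - (a /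
b) dz` vanish on the field. -/
theorem contactFormD_linearField {a b c : ℝ} (hb : b ≠ 0) (y v : ℂ × ℝ) :
    contactFormD a b c y (linearField a b y) v = 0 := by
  simp only [contactFormD, fderiv_contactForm]
  simp [linearField, rsqdθ_apply, rsq, rdr_apply]
  field_simp
  ring

/-- The expression equals `f' / (b r)`, with `f'` the radial derivative of `f`. Written with
`cosRem` it makes sense at `r = 0`, and `r < 1` keeps the argument `π² r²` below `π²`. -/
theorem contactForm_wedge_pos {a b c : ℝ} (hb : 0 < b) (hc : 0 < c) {y : ℂ × ℝ} (hy : ‖y.1‖ < 1) :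
    0 < contactForm a b c y (1, 0) * contactFormD a b c y (Complex.I, 0) (0, 1) +
      contactForm a b c y (Complex.I, 0) * contactFormD a b c y (0, 1) (1, 0) +
      contactForm a b c y (0, 1) * contactFormD a b c y (1, 0) (Complex.I, 0) := by
  have hpi := Real.pi_pos
  have h1 := rsq_eq y
  have h2 : rsq y < 1 := by rw [h1]; exact pow_lt_one₀ (norm_nonneg _) hy two_ne_zero
  have h0 : 0 ≤ rsq y := by rw [h1]; positivity
  have h3 := cosRem_add_mul_deriv_pos (t := Real.pi ^ 2 * rsq y) (by positivity) (by
    have := pow_pos hpi 2; nlinarith)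
  have h4 : 0 < 2 * c * Real.pi ^ 2 / b * (cosRem (Real.pi ^ 2 * rsq y) +
    Real.pi ^ 2 * rsq y * deriv cosRem (Real.pi ^ 2 * rsq y)) := by positivity
  refine h4.trans_eq ?_
  simp only [contactFormD, fderiv_contactForm]
  simp [contactForm, rsqdθ_apply, rdr_apply]
  have h5 : rsq y = y.1.re ^ 2 + y.1.im ^ 2 := rfl
  generalize cosRem (Real.pi ^ 2 * rsq y) = A
  generalize deriv cosRem (Real.pi ^ 2 * rsq y) = B
  rw [h5]
  field_simp
  ring

theorem contactForm_core (a b c : ℝ) (z : ℝ) (v : ℂ) : contactForm a b c (0, z) (v, 0) = 0 := by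
  simp [contactForm, rsqdθ_apply]

/-- On the core the contact plane is the `w`-plane. Its orientation by `dα` is the complex one, so
multiplication by `e^{iφ}` is a rotation by `+φ`. -/
theorem contactFormD_core_pos {a b c : ℝ} (hc : 0 < c) (z : ℝ) :
    0 < contactFormD a b c (0, z) (1, 0) (Complex.I, 0) := by
  have hpi := Real.pi_pos
  simp only [contactFormD, fderiv_contactForm]
  simp [rsq, rdr_apply, rsqdθ_apply, cosRem_zero]
  positivity

/-! ### Cylindrical coordinates and matching of the contact forms -/

/-- Cylindrical coordinates `(r, θ, z) ↦ (r e^{iθ}, z)`. -/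
def polar (ρ : ℝ × ℝ × ℝ) : ℂ × ℝ := (ρ.1 * Complex.exp (ρ.2.1 * Complex.I), ρ.2.2)

/-- The derivative of cylindrical coordinates. -/
def polarDeriv (ρ ν : ℝ × ℝ × ℝ) : ℂ × ℝ :=
  ((ν.1 + ρ.1 * ν.2.1 * Complex.I) * Complex.exp (ρ.2.1 * Complex.I), ν.2.2)

theorem contDiff_polar : ContDiff ℝ ∞ polar := by
  have : ContDiff ℝ ∞ (fun x : ℝ => (x : ℂ)) := Complex.ofRealCLM.contDiff
  unfold polar
  fun_prop

theorem fderiv_polar (ρ ν : ℝ × ℝ × ℝ) : fderiv ℝ polar ρ ν = polarDeriv ρ ν := by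
  have h1 : HasFDerivAt (fun ρ : ℝ × ℝ × ℝ => (ρ.1 : ℂ)) _ ρ :=
    (Complex.ofRealCLM.comp (ContinuousLinearMap.fst ℝ ℝ (ℝ × ℝ))).hasFDerivAt
  have h2 : HasFDerivAt (fun ρ : ℝ × ℝ × ℝ => (ρ.2.1 : ℂ)) _ ρ :=
    (Complex.ofRealCLM.comp ((ContinuousLinearMap.fst ℝ ℝ ℝ).comp
      (ContinuousLinearMap.snd ℝ ℝ (ℝ × ℝ)))).hasFDerivAt
  have h3 : HasFDerivAt (fun ρ : ℝ × ℝ × ℝ => ρ.2.2) _ ρ :=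
    ((ContinuousLinearMap.snd ℝ ℝ ℝ).comp (ContinuousLinearMap.snd ℝ ℝ (ℝ × ℝ))).hasFDerivAt
  have h4 : HasFDerivAt polar _ ρ := (h1.mul (h2.mul_const Complex.I).cexp).prodMk h3
  rw [h4.fderiv]
  simp [polarDeriv]
  ring

/-- Reduces tensor identities off the core to vectors written in cylindrical coordinates, where the
gluing map is affine. -/
theorem polarDeriv_surjective {ρ : ℝ × ℝ × ℝ} (hρ : ρ.1 ≠ 0) (v : ℂ × ℝ) :
    ∃ ν, polarDeriv ρ ν = v := by
  set u := v.1 * Complex.exp (-(ρ.2.1 * Complex.I)) with hu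
  have hr : (ρ.1 : ℂ) ≠ 0 := by exact_mod_cast hρ
  refine ⟨(u.re, u.im / ρ.1, v.2), Prod.ext ?_ rfl⟩
  have h1 : ((u.re : ℂ) + ρ.1 * (u.im / ρ.1 : ℝ) * Complex.I) = u := by
    push_cast
    rw [mul_div_cancel₀ _ hr, Complex.re_add_im]
  simp only [polarDeriv]
  rw [h1, hu, mul_assoc, ← Complex.exp_add, neg_add_cancel, Complex.exp_zero, mul_one]

theorem polar_re (ρ : ℝ × ℝ × ℝ) : (polar ρ).1.re = ρ.1 * Real.cos ρ.2.1 := by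
  simp [polar, Complex.exp_ofReal_mul_I_re]

theorem polar_im (ρ : ℝ × ℝ × ℝ) : (polar ρ).1.im = ρ.1 * Real.sin ρ.2.1 := by
  simp [polar, Complex.exp_ofReal_mul_I_im]

theorem norm_polar {ρ : ℝ × ℝ × ℝ} (hρ : 0 ≤ ρ.1) : ‖(polar ρ).1‖ = ρ.1 := by
  simp [polar, Complex.norm_exp_ofReal_mul_I, abs_of_nonneg hρ]

theorem polarDeriv_re (ρ ν : ℝ × ℝ × ℝ) :
    (polarDeriv ρ ν).1.re = ν.1 * Real.cos ρ.2.1 - ρ.1 * ν.2.1 * Real.sin ρ.2.1 := by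
  simp [polarDeriv, Complex.exp_ofReal_mul_I_re, Complex.exp_ofReal_mul_I_im]

theorem polarDeriv_im (ρ ν : ℝ × ℝ × ℝ) :
    (polarDeriv ρ ν).1.im = ν.1 * Real.sin ρ.2.1 + ρ.1 * ν.2.1 * Real.cos ρ.2.1 := by
  simp [polarDeriv, Complex.exp_ofReal_mul_I_re, Complex.exp_ofReal_mul_I_im]

theorem rdr_polar (ρ ν : ℝ × ℝ × ℝ) : rdr (polar ρ) (polarDeriv ρ ν) = ρ.1 * ν.1 := by
  rw [rdr_apply, polar_re, polar_im, polarDeriv_re, polarDeriv_im]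
  linear_combination ρ.1 * ν.1 * Real.cos_sq_add_sin_sq ρ.2.1

theorem rsqdθ_polar (ρ ν : ℝ × ℝ × ℝ) :
    rsqdθ (polar ρ) (polarDeriv ρ ν) = ρ.1 ^ 2 * ν.2.1 := by
  rw [rsqdθ_apply, polar_re, polar_im, polarDeriv_re, polarDeriv_im]
  linear_combination ρ.1 ^ 2 * ν.2.1 * Real.cos_sq_add_sin_sq ρ.2.1

theorem rsq_polar (ρ : ℝ × ℝ × ℝ) : rsq (polar ρ) = ρ.1 ^ 2 := by
  rw [rsq, dx_apply, dy_apply, polar_re, polar_im]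
  linear_combination ρ.1 ^ 2 * Real.cos_sq_add_sin_sq ρ.2.1

theorem contactForm_polar (a b c : ℝ) (ρ ν : ℝ × ℝ × ℝ) :
    contactForm a b c (polar ρ) (polarDeriv ρ ν) =
      b⁻¹ * ν.2.2 + c * (1 - Real.cos (Real.pi * ρ.1)) * (ν.2.1 - a / b * ν.2.2) := by
  rw [← sq_mul_cosRem, mul_pow]
  have h : (polarDeriv ρ ν).2 = ν.2.2 := rfl
  simp only [contactForm, rsq_polar, add_apply, sub_apply, smul_apply, rsqdθ_polar, dz_apply,
    smul_eq_mul, h]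
  ring

/-- The linear part of the gluing map, `(r, θ, z) ↦ (-r, -a θ + b z, c θ + d z)`. -/
def glueLinear (a b c d : ℤ) : ℝ × ℝ × ℝ →L[ℝ] ℝ × ℝ × ℝ :=
  let θ : ℝ × ℝ × ℝ →L[ℝ] ℝ :=
    (ContinuousLinearMap.fst ℝ ℝ ℝ).comp (ContinuousLinearMap.snd ℝ ℝ (ℝ × ℝ))
  let z : ℝ × ℝ × ℝ →L[ℝ] ℝ :=
    (ContinuousLinearMap.snd ℝ ℝ ℝ).comp (ContinuousLinearMap.snd ℝ ℝ (ℝ × ℝ))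
  (-ContinuousLinearMap.fst ℝ ℝ (ℝ × ℝ)).prod
    ((-(a : ℝ) • θ + (b : ℝ) • z).prod ((c : ℝ) • θ + (d : ℝ) • z))

theorem glueLinear_apply (a b c d : ℤ) (ν : ℝ × ℝ × ℝ) : glueLinear a b c d ν =
    (-ν.1, -a * ν.2.1 + b * ν.2.2, c * ν.2.1 + d * ν.2.2) := rfl

/-- The gluing map in cylindrical coordinates, `(r, θ, z) ↦ (1 - r, -a θ + b z, c θ + d z)`. -/
def glueAffine (a b c d : ℤ) (ρ : ℝ × ℝ × ℝ) : ℝ × ℝ × ℝ := (1, 0, 0) + glueLinear a b c d ρ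

/-- The constant `p / (2 b')` makes `f` tend to `p / b'` as `r → 1`. That is the value at which the
form vanishes on the circle collapsed in the other torus. -/
theorem contactForm_glue {e e' m p : ℤ} (h : m * p + e * e' = 1) {b b' : ℝ} (hb : b ≠ 0)
    (hb' : b' ≠ 0) (hp : p ≠ 0) (ρ ν : ℝ × ℝ × ℝ) :
    contactForm ((b - e' * b') / p) b' (p / (2 * b)) (polar (glueAffine e' m p e ρ))
        (polarDeriv (glueAffine e' m p e ρ) (glueLinear e' m p e ν)) =
      contactForm ((b' - e * b) / p) b (p / (2 * b')) (polar ρ) (polarDeriv ρ ν) := by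
  rw [contactForm_polar, contactForm_polar]
  have hp' : (p : ℝ) ≠ 0 := by exact_mod_cast hp
  have h' : (m * p + e * e' : ℝ) = 1 := by exact_mod_cast h
  have h1 : Real.cos (Real.pi * (glueAffine e' m p e ρ).1) = -Real.cos (Real.pi * ρ.1) := by
    have : Real.pi * (glueAffine e' m p e ρ).1 = Real.pi - Real.pi * ρ.1 := by
      simp [glueAffine, glueLinear_apply]; ring
    rw [this, Real.cos_pi_sub]
  rw [h1, glueLinear_apply]
  generalize Real.cos (Real.pi * ρ.1) = C
  field_simp
  -- The determinant condition eliminates `m`, leaving a rational identity in the independent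
  -- variables.
  have hm : (m : ℝ) = (1 - e * e') / p := by field_simp; linarith
  rw [hm]
  field_simp
  ring

/-! ### The invariant metric on a solid torus -/

/-- A smooth cutoff function, equal to `1` for `r ≤ 1 / 3` and to `0` for `r ≥ 2 / 3`. -/
def cutoff (r : ℝ) : ℝ := Real.smoothTransition (2 - 3 * r)

theorem contDiff_cutoff : ContDiff ℝ ∞ cutoff :=
  Real.smoothTransition.contDiff.comp (contDiff_const.sub (contDiff_const.mul contDiff_id))

theorem cutoff_of_le {r : ℝ} (hr : r ≤ 1 / 3) : cutoff r = 1 :=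
  Real.smoothTransition.one_of_one_le (by linarith)

theorem cutoff_of_ge {r : ℝ} (hr : 2 / 3 ≤ r) : cutoff r = 0 :=
  Real.smoothTransition.zero_of_nonpos (by linarith)

theorem cutoff_pos {r : ℝ} (hr : r < 2 / 3) : 0 < cutoff r :=
  Real.smoothTransition.pos_of_pos (by linarith)

theorem cutoff_nonneg (r : ℝ) : 0 ≤ cutoff r := Real.smoothTransition.nonneg _

/-- The flat metric `dr² + r² dθ² + dz²`. -/
def flatMetric : ℂ × ℝ →L[ℝ] ℂ × ℝ →L[ℝ] ℝ :=
  dx.smulRight dx + dy.smulRight dy + dz.smulRight dz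

/-- The pullback of the flat metric by the gluing map. -/
def gluedMetric (a b c d : ℤ) (y : ℂ × ℝ) : ℂ × ℝ →L[ℝ] ℂ × ℝ →L[ℝ] ℝ :=
  let dr : ℂ × ℝ →L[ℝ] ℝ := ‖y.1‖⁻¹ • rdr y
  let dθ : ℂ × ℝ →L[ℝ] ℝ := (rsq y)⁻¹ • rsqdθ y
  let μ : ℂ × ℝ →L[ℝ] ℝ := -(a : ℝ) • dθ + (b : ℝ) • dz
  let κ : ℂ × ℝ →L[ℝ] ℝ := (c : ℝ) • dθ + (d : ℝ) • dz
  dr.smulRight dr + (1 - ‖y.1‖) ^ 2 • μ.smulRight μ + κ.smulRight κ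

/-- A toric metric on the solid torus that is compatible with the gluing map. -/
def metric (a b c d : ℤ) (y : ℂ × ℝ) : ℂ × ℝ →L[ℝ] ℂ × ℝ →L[ℝ] ℝ :=
  cutoff ‖y.1‖ • flatMetric + cutoff (1 - ‖y.1‖) • gluedMetric a b c d y

theorem flatMetric_apply (v w : ℂ × ℝ) :
    flatMetric v w = v.1.re * w.1.re + v.1.im * w.1.im + v.2 * w.2 := rfl

theorem gluedMetric_apply (a b c d : ℤ) (y v w : ℂ × ℝ) : gluedMetric a b c d y v w =
    (‖y.1‖⁻¹ * rdr y v) * (‖y.1‖⁻¹ * rdr y w) +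
    (1 - ‖y.1‖) ^ 2 * ((-a * ((rsq y)⁻¹ * rsqdθ y v) + b * v.2) *
      (-a * ((rsq y)⁻¹ * rsqdθ y w) + b * w.2)) +
    (c * ((rsq y)⁻¹ * rsqdθ y v) + d * v.2) * (c * ((rsq y)⁻¹ * rsqdθ y w) + d * w.2) := rfl

theorem metric_apply (a b c d : ℤ) (y v w : ℂ × ℝ) : metric a b c d y v w =
    cutoff ‖y.1‖ * flatMetric v w + cutoff (1 - ‖y.1‖) * gluedMetric a b c d y v w := rfl

theorem metric_symm (a b c d : ℤ) (y v w : ℂ × ℝ) :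
    metric a b c d y v w = metric a b c d y w v := by
  simp only [metric_apply, flatMetric_apply, gluedMetric_apply]
  ring

set_option maxSynthPendingDepth 3 in
theorem contDiff_metric (a b c d : ℤ) : ContDiff ℝ ∞ (metric a b c d) := by
  rw [contDiff_iff_contDiffAt]
  intro y
  by_cases hy : y.1 = 0
  -- The glued metric is singular at `r = 0`, but its weight `cutoff (1 - r)` vanishes identically
  -- near the core.
  · have h1 : metric a b c d =ᶠ[𝓝 y] fun _ => flatMetric := by
      have h2 : ∀ᶠ y' : ℂ × ℝ in 𝓝 y, ‖y'.1‖ < 1 / 3 :=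
        (isOpen_lt (by fun_prop) continuous_const).mem_nhds
          (show ‖y.1‖ < 1 / 3 by rw [hy]; norm_num)
      filter_upwards [h2] with y' hy'
      rw [metric, cutoff_of_le hy'.le, cutoff_of_ge (by linarith), one_smul, zero_smul, add_zero]
    exact contDiffAt_const.congr_of_eventuallyEq h1
  · have hn : ContDiffAt ℝ ∞ (fun y : ℂ × ℝ => ‖y.1‖) y := contDiffAt_fst.norm ℝ hy
    have hr : ContDiffAt ℝ ∞ rsq y := by unfold rsq; fun_prop
    have hn0 : ‖y.1‖ ≠ 0 := norm_ne_zero_iff.2 hy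
    have hr0 : rsq y ≠ 0 := by rw [rsq_eq]; positivity
    have hc := contDiff_cutoff
    have hdr : ContDiffAt ℝ ∞ (fun y : ℂ × ℝ => ‖y.1‖⁻¹ • rdr y) y := by
      refine (hn.inv hn0).smul ?_
      unfold rdr; fun_prop
    have hdθ : ContDiffAt ℝ ∞ (fun y : ℂ × ℝ => (rsq y)⁻¹ • rsqdθ y) y := by
      refine (hr.inv hr0).smul ?_
      unfold rsqdθ; fun_prop
    have hμ : ∀ a b : ℝ, ContDiffAt ℝ ∞
        (fun y : ℂ × ℝ => a • ((rsq y)⁻¹ • rsqdθ y) + b • dz) y := fun a b =>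
      (hdθ.const_smul a).add contDiffAt_const
    unfold metric gluedMetric
    exact ((hc.contDiffAt.comp y hn).smul contDiffAt_const).add
      ((hc.contDiffAt.comp y (contDiffAt_const.sub hn)).smul
        (((hdr.smulRight hdr).add (((contDiffAt_const.sub hn).pow 2).smul
          ((hμ _ _).smulRight (hμ _ _)))).add ((hμ _ _).smulRight (hμ _ _))))

/-- The flat summand suffices for `r < 2 / 3`. Beyond that the glued summand has weight `1` and is
definite, because `r ≠ 0`, `r ≠ 1` and the gluing matrix is invertible. -/
theorem metric_pos {a b c d : ℤ} (h : b * c + a * d = 1) {y : ℂ × ℝ} (hy : ‖y.1‖ < 1)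
    {v : ℂ × ℝ} (hv : v ≠ 0) : 0 < metric a b c d y v v := by
  have hf : 0 < flatMetric v v := by
    rw [flatMetric_apply]
    by_contra hneg
    refine hv (Prod.ext (Complex.ext ?_ ?_) ?_) <;> simp only [Prod.fst_zero, Prod.snd_zero,
      Complex.zero_re, Complex.zero_im] <;>
      nlinarith [mul_self_nonneg v.1.re, mul_self_nonneg v.1.im, mul_self_nonneg v.2]
  have hg0 : 0 ≤ gluedMetric a b c d y v v := by
    rw [gluedMetric_apply]
    exact add_nonneg (add_nonneg (mul_self_nonneg _)
      (mul_nonneg (sq_nonneg _) (mul_self_nonneg _))) (mul_self_nonneg _)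
  rw [metric_apply]
  rcases lt_or_ge ‖y.1‖ (2 / 3) with h1 | h1
  · exact add_pos_of_pos_of_nonneg (mul_pos (cutoff_pos h1) hf)
      (mul_nonneg (cutoff_nonneg _) hg0)
  rw [cutoff_of_ge h1, zero_mul, zero_add, cutoff_of_le (by linarith), one_mul]
  refine hg0.lt_of_ne' fun h0 => hv ?_
  have hn0 : ‖y.1‖ ≠ 0 := by linarith
  have hr0 : rsq y ≠ 0 := by rw [rsq_eq]; positivity
  have hn1 : (1 - ‖y.1‖) ^ 2 ≠ 0 := pow_ne_zero _ (by linarith)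
  rw [gluedMetric_apply] at h0
  set X := (rsq y)⁻¹ * rsqdθ y v with hX
  have e1 := mul_self_nonneg (‖y.1‖⁻¹ * rdr y v)
  have e2 := mul_nonneg (sq_nonneg (1 - ‖y.1‖)) (mul_self_nonneg (-a * X + b * v.2))
  have e3 := mul_self_nonneg (c * X + d * v.2)
  have f1 : rdr y v = 0 := by
    have : (‖y.1‖⁻¹ * rdr y v) * (‖y.1‖⁻¹ * rdr y v) = 0 := by linarith
    simpa [hn0] using this
  have f2 : -a * X + b * v.2 = 0 := by
    have : (1 - ‖y.1‖) ^ 2 * ((-a * X + b * v.2) * (-a * X + b * v.2)) = 0 := by linarith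
    exact mul_self_eq_zero.1 ((mul_eq_zero.1 this).resolve_left hn1)
  have f3 : c * X + d * v.2 = 0 := mul_self_eq_zero.1 (by linarith)
  have h' : (b * c + a * d : ℝ) = 1 := by exact_mod_cast h
  -- These two combinations apply the inverse of the gluing matrix, which has determinant `-1`.
  have g1 : X = 0 := by linear_combination (-d : ℝ) * f2 + (b : ℝ) * f3 - X * h'
  have g2 : v.2 = 0 := by linear_combination (c : ℝ) * f2 + (a : ℝ) * f3 - v.2 * h'
  have g3 : rsqdθ y v = 0 := by
    rw [hX] at g1
    exact (mul_eq_zero.1 g1).resolve_left (inv_ne_zero hr0)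
  rw [rdr_apply] at f1
  rw [rsqdθ_apply] at g3
  have hr : rsq y = y.1.re ^ 2 + y.1.im ^ 2 := rfl
  refine Prod.ext (Complex.ext ?_ ?_) g2
  · refine (mul_eq_zero.1 ?_).resolve_left hr0
    rw [hr]
    linear_combination y.1.re * f1 - y.1.im * g3
  · refine (mul_eq_zero.1 ?_).resolve_left hr0
    rw [hr]
    linear_combination y.1.im * f1 + y.1.re * g3

theorem metric_polar (a b c d : ℤ) {ρ : ℝ × ℝ × ℝ} (hρ : 0 < ρ.1) (ν ξ : ℝ × ℝ × ℝ) :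
    metric a b c d (polar ρ) (polarDeriv ρ ν) (polarDeriv ρ ξ) =
      cutoff ρ.1 * (ν.1 * ξ.1 + ρ.1 ^ 2 * ν.2.1 * ξ.2.1 + ν.2.2 * ξ.2.2) +
      cutoff (1 - ρ.1) * (ν.1 * ξ.1 + (1 - ρ.1) ^ 2 * ((-a * ν.2.1 + b * ν.2.2) *
        (-a * ξ.2.1 + b * ξ.2.2)) + (c * ν.2.1 + d * ν.2.2) * (c * ξ.2.1 + d * ξ.2.2)) := by
  rw [metric_apply, flatMetric_apply, gluedMetric_apply, norm_polar hρ.le, rsq_polar]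
  simp only [rdr_polar, rsqdθ_polar, polarDeriv_re, polarDeriv_im]
  have h1 : ∀ x : ℝ, ρ.1⁻¹ * (ρ.1 * x) = x := fun x => inv_mul_cancel_left₀ hρ.ne' x
  have h2 : ∀ x : ℝ, (ρ.1 ^ 2)⁻¹ * (ρ.1 ^ 2 * x) = x := fun x =>
    inv_mul_cancel_left₀ (pow_ne_zero 2 hρ.ne') x
  simp only [h1, h2]
  have h3 := Real.cos_sq_add_sin_sq ρ.2.1
  simp only [polarDeriv]
  linear_combination cutoff ρ.1 * (ν.1 * ξ.1 + ρ.1 ^ 2 * ν.2.1 * ξ.2.1) * h3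

/-- Gluing exchanges `r` with `1 - r`, and the two gluing matrices are inverse to each other; hence
the two weighted summands trade places. -/
theorem metric_glue {e e' m p : ℤ} (h : m * p + e * e' = 1) {ρ : ℝ × ℝ × ℝ} (h0 : 0 < ρ.1)
    (h1 : ρ.1 < 1) (ν ξ : ℝ × ℝ × ℝ) :
    metric e m p e' (polar (glueAffine e' m p e ρ))
        (polarDeriv (glueAffine e' m p e ρ) (glueLinear e' m p e ν))
        (polarDeriv (glueAffine e' m p e ρ) (glueLinear e' m p e ξ)) =
      metric e' m p e (polar ρ) (polarDeriv ρ ν) (polarDeriv ρ ξ) := by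
  have h2 : (glueAffine e' m p e ρ).1 = 1 - ρ.1 := by
    simp [glueAffine, glueLinear_apply]; ring
  have h' : (m * p + e * e' : ℝ) = 1 := by exact_mod_cast h
  rw [metric_polar _ _ _ _ (by rw [h2]; linarith), metric_polar _ _ _ _ h0, h2, sub_sub_cancel]
  simp only [glueLinear_apply]
  have k1 : ∀ ν : ℝ × ℝ × ℝ, -(e : ℝ) * (-e' * ν.2.1 + m * ν.2.2) +
      m * (p * ν.2.1 + e * ν.2.2) = ν.2.1 := fun ν => by linear_combination ν.2.1 * h'
  have k2 : ∀ ν : ℝ × ℝ × ℝ, (p : ℝ) * (-e' * ν.2.1 + m * ν.2.2) +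
      e' * (p * ν.2.1 + e * ν.2.2) = ν.2.2 := fun ν => by linear_combination ν.2.2 * h'
  rw [k1, k1, k2, k2]
  ring

/-! ### The linear flow on a solid torus -/

/-- The flow of `linearField`. -/
def linearFlow (a b t : ℝ) (y : ℂ × ℝ) : ℂ × ℝ :=
  (Complex.exp (a * t * Complex.I) * y.1, y.2 + b * t)

/-- The derivative of `linearFlow`. -/
def linearFlowDeriv (a t : ℝ) : ℂ × ℝ →L[ℝ] ℂ × ℝ :=
  (Complex.exp (a * t * Complex.I) • ContinuousLinearMap.fst ℝ ℂ ℝ).prod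
    (ContinuousLinearMap.snd ℝ ℂ ℝ)

theorem linearFlowDeriv_apply (a t : ℝ) (v : ℂ × ℝ) :
    linearFlowDeriv a t v = (Complex.exp (a * t * Complex.I) * v.1, v.2) := rfl

theorem linearFlow_eq (a b t : ℝ) (y : ℂ × ℝ) :
    linearFlow a b t y = linearFlowDeriv a t y + (0, b * t) := by
  rw [linearFlow, linearFlowDeriv_apply]; simp

theorem hasFDerivAt_linearFlow (a b t : ℝ) (y : ℂ × ℝ) :
    HasFDerivAt (linearFlow a b t) (linearFlowDeriv a t) y := by
  rw [show linearFlow a b t = _ from funext (linearFlow_eq a b t)]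
  exact (linearFlowDeriv a t).hasFDerivAt.add_const _

theorem norm_linearFlow (a b t : ℝ) (y : ℂ × ℝ) : ‖(linearFlow a b t y).1‖ = ‖y.1‖ := by
  have : (a * t * Complex.I : ℂ) = ((a * t : ℝ) : ℂ) * Complex.I := by push_cast; rfl
  rw [linearFlow, norm_mul, this, Complex.norm_exp_ofReal_mul_I, one_mul]

theorem contDiff_linearFlow (a b : ℝ) :
    ContDiff ℝ ∞ (fun z : ℝ × ℂ × ℝ => linearFlow a b z.1 z.2) := by
  have : ContDiff ℝ ∞ (fun x : ℝ => (x : ℂ)) := Complex.ofRealCLM.contDiff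
  unfold linearFlow
  fun_prop

theorem hasDerivAt_linearFlow (a b : ℝ) (y : ℂ × ℝ) :
    HasDerivAt (fun t => linearFlow a b t y) (linearField a b y) 0 := by
  have h1 : HasDerivAt (fun t : ℝ => (a * t * Complex.I : ℂ)) (a * Complex.I) 0 := by
    have := (((hasDerivAt_id (0 : ℝ)).ofReal_comp).const_mul (a : ℂ)).mul_const Complex.I
    simpa using this
  have h2 := (h1.cexp).mul_const y.1
  have h3 : HasDerivAt (fun t : ℝ => y.2 + b * t) b 0 := by
    simpa using ((hasDerivAt_id (0 : ℝ)).const_mul b).const_add y.2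
  have h4 := h2.prodMk h3
  simpa [linearFlow, linearField] using h4

/-- The metric is built from `r`, `r dr`, `r² dθ`, `dz` and the Euclidean metric, all invariant
under rotation in `w` and translation in `z`. -/
theorem metric_linearFlow (a b c d : ℤ) (a' b' t : ℝ) (y v w : ℂ × ℝ) :
    metric a b c d (linearFlow a' b' t y) (linearFlowDeriv a' t v) (linearFlowDeriv a' t w) =
      metric a b c d y v w := by
  have e0 : (a' * t * Complex.I : ℂ) = ((a' * t : ℝ) : ℂ) * Complex.I := by push_cast; rfl
  have h1 := Real.cos_sq_add_sin_sq (a' * t)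
  have h2 : ∀ u : ℂ, (Complex.exp (a' * t * Complex.I) * u).re =
      Real.cos (a' * t) * u.re - Real.sin (a' * t) * u.im := fun u => by
    rw [e0, Complex.mul_re, Complex.exp_ofReal_mul_I_re, Complex.exp_ofReal_mul_I_im]
  have h3 : ∀ u : ℂ, (Complex.exp (a' * t * Complex.I) * u).im =
      Real.cos (a' * t) * u.im + Real.sin (a' * t) * u.re := fun u => by
    rw [e0, Complex.mul_im, Complex.exp_ofReal_mul_I_re, Complex.exp_ofReal_mul_I_im]
  have h4 : ∀ u, rdr (linearFlow a' b' t y) (linearFlowDeriv a' t u) = rdr y u := fun u => by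
    simp only [rdr_apply, linearFlow, linearFlowDeriv_apply, h2, h3]
    linear_combination (y.1.re * u.1.re + y.1.im * u.1.im) * h1
  have h5 : ∀ u, rsqdθ (linearFlow a' b' t y) (linearFlowDeriv a' t u) = rsqdθ y u := fun u => by
    simp only [rsqdθ_apply, linearFlow, linearFlowDeriv_apply, h2, h3]
    linear_combination (y.1.re * u.1.im - y.1.im * u.1.re) * h1
  have h6 : flatMetric (linearFlowDeriv a' t v) (linearFlowDeriv a' t w) = flatMetric v w := by
    simp only [flatMetric_apply, linearFlowDeriv_apply, h2, h3]
    linear_combination (v.1.re * w.1.re + v.1.im * w.1.im) * h1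
  rw [metric_apply, metric_apply, h6, gluedMetric_apply, gluedMetric_apply, h4, h4, h5, h5,
    rsq_eq, rsq_eq, norm_linearFlow]
  rfl

/-! ### The gluing map in cylindrical coordinates -/

theorem exp_arg_polar {ρ : ℝ × ℝ × ℝ} (hρ : 0 < ρ.1) :
    Circle.exp (polar ρ).1.arg = Circle.exp ρ.2.1 := by
  have h : (polar ρ).1 = (ρ.1 : ℂ) * (Circle.exp ρ.2.1 : ℂ) := by rw [Circle.coe_exp]; rfl
  rw [h, Complex.arg_real_mul _ hρ, Circle.exp_arg]

theorem exists_polar (w : ℂ) (z : ℝ) :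
    ∃ ρ : ℝ × ℝ × ℝ, ρ.1 = ‖w‖ ∧ polar ρ = (w, z) :=
  ⟨(‖w‖, w.arg, z), rfl, Prod.ext (Complex.norm_mul_exp_arg_mul_I w) rfl⟩

/-- The argument enters `glue` only through `Circle.exp`, so no branch has to be chosen and any real
angle serves. -/
theorem glue_polar (a b c d : ℤ) {ρ : ℝ × ℝ × ℝ} (hρ : 0 < ρ.1) :
    glue a b c d ((polar ρ).1, Circle.exp (polar ρ).2) =
      ((polar (glueAffine a b c d ρ)).1, Circle.exp (polar (glueAffine a b c d ρ)).2) := by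
  have hz : ∀ (n : ℤ) (t : ℝ), Circle.exp t ^ n = Circle.exp (n * t) := fun n t => by
    rw [← zsmul_eq_mul, Circle.exp_zsmul]
  have h1 : glueAffine a b c d ρ =
      (1 - ρ.1, -a * ρ.2.1 + b * ρ.2.2, c * ρ.2.1 + d * ρ.2.2) := by
    simp [glueAffine, glueLinear_apply, sub_eq_add_neg]
  rw [glue, norm_polar hρ.le, exp_arg_polar hρ, h1, hz, hz, hz, hz, ← Circle.exp_add,
    ← Circle.exp_add, Circle.coe_exp]
  simp [polar]

theorem norm_glueAffine_polar (a b c d : ℤ) {ρ : ℝ × ℝ × ℝ} (h1 : ρ.1 < 1) :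
    ‖(polar (glueAffine a b c d ρ)).1‖ = 1 - ρ.1 := by
  have : (glueAffine a b c d ρ).1 = 1 - ρ.1 := by
    simp [glueAffine, glueLinear_apply, sub_eq_add_neg]
  rw [norm_polar (by rw [this]; linarith), this]

end SolidTorus

open SolidTorus

/-! ### Parametrizations of the lens space and descent of tensors -/

namespace LensSpace

variable {p q m s : ℤ} {h : m * p + s * q = 1}

/-- The coefficient of `z` in the last coordinate of the transition map leaving the `j`-th
solid torus. -/
def twist (q s : ℤ) (j : Fin 2) : ℤ := if j = 1 then s else q

theorem transition_eq {j k : Fin 2} (hjk : j ≠ k) :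
    transition p q m s j = glue (twist q s k) m p (twist q s j) := by
  fin_cases j <;> fin_cases k <;> simp [transition, twist] at hjk ⊢

theorem twist_mul_twist (h : m * p + s * q = 1) {j k : Fin 2} (hjk : j ≠ k) :
    m * p + twist q s j * twist q s k = 1 := by
  fin_cases j <;> fin_cases k <;> simp [twist] at hjk ⊢ <;> linarith

theorem param_eq_ψ (j : Fin 2) {y : ℂ × ℝ} (hy : ‖y.1‖ < 1) :
    param h j y = ψ h j ⟨(y.1, Circle.exp y.2), hy⟩ :=
  toroidal_symm j (x := (y.1, Circle.exp y.2)) hy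

theorem exists_param (x : LensSpace p q m s h) : ∃ j y, ‖y.1‖ < 1 ∧ param h j y = x := by
  obtain ⟨j, y, rfl⟩ := exists_ψ x
  obtain ⟨⟨w, ζ⟩, hy⟩ := y
  refine ⟨j, (w, Complex.arg ζ), hy, ?_⟩
  rw [param_eq_ψ j hy]
  simp

theorem param_add_int (j : Fin 2) (y : ℂ × ℝ) (n : ℤ) :
    param h j (y + (0, 2 * Real.pi * n)) = param h j y := by
  have : Circle.exp (y.2 + 2 * Real.pi * n) = Circle.exp y.2 := by
    rw [Circle.exp_eq_exp]; exact ⟨n, by ring⟩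
  simp [param, this]

theorem param_polar {j k : Fin 2} (hjk : j ≠ k) {ρ : ℝ × ℝ × ℝ} (h0 : 0 < ρ.1) (h1 : ρ.1 < 1) :
    param h j (polar ρ) =
      param h k (polar (glueAffine (twist q s k) m p (twist q s j) ρ)) := by
  have hn := norm_polar h0.le
  rw [param_eq_ψ j (by rw [hn]; exact h1),
    param_eq_ψ k (by rw [norm_glueAffine_polar _ _ _ _ h1]; linarith), ψ_eq_iff]
  refine Or.inr ⟨hjk, ?_, ?_⟩
  · rw [← norm_ne_zero_iff, hn]; exact h0.ne'
  · rw [transition_eq hjk, glue_polar _ _ _ _ h0]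

/-- This splits every check of independence from the parametrization into two cases: a translation
of `z` by a multiple of `2π`, and the affine gluing map off the cores. -/
theorem param_eq_param {j k : Fin 2} {y y' : ℂ × ℝ} (hy : ‖y.1‖ < 1) (hy' : ‖y'.1‖ < 1)
    (hyy' : param h j y = param h k y') :
    (j = k ∧ ∃ n : ℤ, y' = y + (0, 2 * Real.pi * n)) ∨
    (j ≠ k ∧ ∃ (ρ : ℝ × ℝ × ℝ) (n : ℤ), 0 < ρ.1 ∧ ρ.1 < 1 ∧ y = polar ρ ∧
      y' = polar (glueAffine (twist q s k) m p (twist q s j) ρ) + (0, 2 * Real.pi * n)) := by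
  have key : ∀ {u : ℂ × ℝ}, u.1 = y'.1 → Circle.exp u.2 = Circle.exp y'.2 →
      ∃ n : ℤ, y' = u + (0, 2 * Real.pi * n) := by
    intro u h1 h2
    obtain ⟨n, hn⟩ := Circle.exp_eq_exp.1 h2.symm
    exact ⟨n, Prod.ext (by simp [h1]) (by simp [hn]; ring)⟩
  rw [param_eq_ψ j hy, param_eq_ψ k hy', ψ_eq_iff] at hyy'
  rcases hyy' with ⟨rfl, h2⟩ | ⟨hjk, h2, h3⟩
  · rw [Subtype.mk.injEq, Prod.mk.injEq] at h2
    exact Or.inl ⟨rfl, key h2.1 h2.2⟩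
  · obtain ⟨ρ, hρ, hρy⟩ := exists_polar y.1 y.2
    have h0 : 0 < ρ.1 := by rw [hρ]; exact norm_pos_iff.2 h2
    have hy2 : y = polar ρ := hρy.symm
    refine Or.inr ⟨hjk, ρ, ?_⟩
    rw [transition_eq hjk] at h3
    subst hy2
    rw [glue_polar _ _ _ _ h0] at h3
    obtain ⟨n, hn⟩ := key (Prod.ext_iff.1 h3).1.symm (Prod.ext_iff.1 h3).2.symm
    exact ⟨n, h0, by rw [norm_polar h0.le] at hy; exact hy, rfl, hn⟩

/-- Near `y` the parametrization is the inverse of the chart centred at `e^{iz}`, composed with the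
smooth passage from `z` to the branch of the angle used there. -/
theorem contMDiffAt_param (j : Fin 2) {y : ℂ × ℝ} (hy : ‖y.1‖ < 1) :
    ContMDiffAt 𝓘(ℝ, ℂ × ℝ) 𝓘(ℝ, ℂ × ℝ) ∞ (param h j) y := by
  set ζ := Circle.exp y.2 with hζ
  have hmem : ψ h j ⟨(y.1, ζ), hy⟩ ∈ (chart h j ζ).source := mem_chart_source j ⟨(y.1, ζ), hy⟩
  have hopen : {y' : ℂ × ℝ | ‖y'.1‖ < 1 ∧ Circle.exp y'.2 ∈ (angleChart ζ).source} ∈ 𝓝 y := by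
    refine IsOpen.mem_nhds ?_ ⟨hy, by simp [angleChart, hζ]⟩
    exact (isOpen_lt continuous_fst.norm continuous_const).inter
      ((angleChart ζ).open_source.preimage (Circle.exp.continuous.comp continuous_snd))
  have h1 : ContDiffAt ℝ ∞ (fun y' : ℂ × ℝ => (y'.1, angleChart ζ (Circle.exp y'.2))) y :=
    contDiffAt_fst.prodMk (contDiffAt_angleChart ζ contDiffAt_circleExp
      (by simp [angleChart, hζ]))
  have h2 : ContMDiffOn 𝓘(ℝ, ℂ × ℝ) 𝓘(ℝ, ℂ × ℝ) ∞ (chart h j ζ).symm (chart h j ζ).target :=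
    contMDiffOn_symm_of_mem_maximalAtlas
      (IsManifold.subset_maximalAtlas (I := 𝓘(ℝ, ℂ × ℝ)) ⟨j, ζ, rfl⟩)
  have h3 : ∀ y' : ℂ × ℝ, ∀ hy' : ‖y'.1‖ < 1,
      chart h j ζ (ψ h j ⟨(y'.1, Circle.exp y'.2), hy'⟩) =
        (y'.1, angleChart ζ (Circle.exp y'.2)) := fun y' hy' => by
    rw [chart_apply, toroidal_ψ]
  have h4 := (h2.contMDiffAt ((chart h j ζ).open_target.mem_nhds
    ((chart h j ζ).map_source hmem)))
  rw [h3 y hy] at h4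
  refine (h4.comp y h1.contMDiffAt).congr_of_eventuallyEq ?_
  filter_upwards [hopen] with y' hy'
  have h5 : ψ h j ⟨(y'.1, Circle.exp y'.2), hy'.1⟩ ∈ (chart h j ζ).source := by
    rw [mem_chart_source_iff, toroidal_ψ]
    exact ⟨mem_range_self _, hy'.2⟩
  rw [Function.comp_apply, ← h3 y' hy'.1, (chart h j ζ).left_inv h5, param_eq_ψ]

theorem mdifferentiableAt_param (j : Fin 2) {y : ℂ × ℝ} (hy : ‖y.1‖ < 1) :
    MDifferentiableAt 𝓘(ℝ, ℂ × ℝ) 𝓘(ℝ, ℂ × ℝ) (param h j) y :=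
  (contMDiffAt_param j hy).mdifferentiableAt (by simp)

/-- The derivative of `param`, with tangent spaces identified with the model space. -/
def paramDeriv (h : m * p + s * q = 1) (j : Fin 2) (y : ℂ × ℝ) : ℂ × ℝ →L[ℝ] ℂ × ℝ :=
  mfderiv 𝓘(ℝ, ℂ × ℝ) 𝓘(ℝ, ℂ × ℝ) (param h j) y

theorem mfderiv_param_comp {F : Type*} [NormedAddCommGroup F] [NormedSpace ℝ F] (j : Fin 2)
    {f : F → ℂ × ℝ} {x : F} (hf : DifferentiableAt ℝ f x) (hx : ‖(f x).1‖ < 1) (v : F) :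
    (mfderiv 𝓘(ℝ, F) 𝓘(ℝ, ℂ × ℝ) (param h j ∘ f) x : F →L[ℝ] ℂ × ℝ) v =
      paramDeriv h j (f x) (fderiv ℝ f x v) := by
  have h1 := mfderiv_comp x (mdifferentiableAt_param (h := h) j hx) hf.mdifferentiableAt
  rw [mfderiv_eq_fderiv] at h1
  exact DFunLike.congr_fun h1 v

theorem paramDeriv_add_int (j : Fin 2) {y : ℂ × ℝ} (hy : ‖y.1‖ < 1) (n : ℤ) :
    paramDeriv h j (y + (0, 2 * Real.pi * n)) = paramDeriv h j y := by
  set f : ℂ × ℝ → ℂ × ℝ := fun y => y + (0, 2 * Real.pi * n) with hf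
  have hd : HasFDerivAt f (ContinuousLinearMap.id ℝ (ℂ × ℝ)) y :=
    (hasFDerivAt_id y).add_const _
  have h1 : param h j ∘ f = param h j := funext fun y => param_add_int j y n
  refine ContinuousLinearMap.ext fun v => ?_
  have h2 := mfderiv_param_comp (h := h) j hd.differentiableAt (by simpa [hf] using hy) v
  rw [hd.fderiv, h1] at h2
  exact h2.symm

theorem paramDeriv_polar {j k : Fin 2} (hjk : j ≠ k) {ρ : ℝ × ℝ × ℝ} (h0 : 0 < ρ.1)
    (h1 : ρ.1 < 1) (ν : ℝ × ℝ × ℝ) :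
    paramDeriv h j (polar ρ) (polarDeriv ρ ν) =
      paramDeriv h k (polar (glueAffine (twist q s k) m p (twist q s j) ρ))
        (polarDeriv (glueAffine (twist q s k) m p (twist q s j) ρ)
          (glueLinear (twist q s k) m p (twist q s j) ν)) := by
  set g := glueAffine (twist q s k) m p (twist q s j) with hg
  have hd : HasFDerivAt g (glueLinear (twist q s k) m p (twist q s j)) ρ :=
    (glueLinear (twist q s k) m p (twist q s j)).hasFDerivAt.const_add _
  have hp := contDiff_polar.differentiable (by simp)
  have e : param h j ∘ polar =ᶠ[𝓝 ρ] param h k ∘ (polar ∘ g) := by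
    have ho : {ρ : ℝ × ℝ × ℝ | 0 < ρ.1 ∧ ρ.1 < 1} ∈ 𝓝 ρ :=
      ((isOpen_lt continuous_const continuous_fst).inter
        (isOpen_lt continuous_fst continuous_const)).mem_nhds ⟨h0, h1⟩
    filter_upwards [ho] with ρ' hρ'
    exact param_polar hjk hρ'.1 hρ'.2
  have e1 := mfderiv_param_comp (h := h) j (hp ρ) (by rw [norm_polar h0.le]; exact h1) ν
  have e2 := mfderiv_param_comp (h := h) k (f := polar ∘ g)
    ((hp (g ρ)).comp ρ hd.differentiableAt)
    (by rw [Function.comp_apply, norm_glueAffine_polar _ _ _ _ h1]; linarith) ν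
  rw [fderiv_comp ρ (hp (g ρ)) hd.differentiableAt, hd.fderiv, ContinuousLinearMap.comp_apply,
    fderiv_polar] at e2
  rw [fderiv_polar] at e1
  rw [← e1]
  refine Eq.trans ?_ e2
  exact DFunLike.congr_fun e.mfderiv_eq ν

/-- The index of the solid torus on which the chart at `x` is defined. -/
def chartIdx (x : LensSpace p q m s h) : Fin 2 := (exists_ψ x).choose

theorem chartAt_eq (x : LensSpace p q m s h) :
    ∃ ζ, chartAt (ℂ × ℝ) x = chart h (chartIdx x) ζ := ⟨_, rfl⟩

theorem norm_lt_of_mem_chartAt_target {x : LensSpace p q m s h} {y : ℂ × ℝ}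
    (hy : y ∈ (chartAt (ℂ × ℝ) x).target) : ‖y.1‖ < 1 := by
  obtain ⟨ζ, hζ⟩ := chartAt_eq x
  rw [hζ] at hy
  exact norm_lt_of_mem_chart_target hy

theorem chartAt_symm_eq {x : LensSpace p q m s h} {y : ℂ × ℝ}
    (hy : y ∈ (chartAt (ℂ × ℝ) x).target) :
    (chartAt (ℂ × ℝ) x).symm y = param h (chartIdx x) y := by
  have h1 := norm_lt_of_mem_chartAt_target hy
  obtain ⟨ζ, hζ⟩ := chartAt_eq x
  rw [hζ, chart_symm_apply h1, param_eq_ψ _ h1]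

theorem mfderiv_chartAt_symm {x : LensSpace p q m s h} {y : ℂ × ℝ}
    (hy : y ∈ (chartAt (ℂ × ℝ) x).target) :
    mfderiv 𝓘(ℝ, ℂ × ℝ) 𝓘(ℝ, ℂ × ℝ) (chartAt (ℂ × ℝ) x).symm y =
      paramDeriv h (chartIdx x) y := by
  refine Filter.EventuallyEq.mfderiv_eq ?_
  filter_upwards [(chartAt (ℂ × ℝ) x).open_target.mem_nhds hy] with y' hy'
  exact chartAt_symm_eq hy'

theorem norm_chartAt_self (x : LensSpace p q m s h) : ‖(chartAt (ℂ × ℝ) x x).1‖ < 1 :=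
  norm_lt_of_mem_chartAt_target (mem_chart_target _ x)

theorem param_chartAt {x x' : LensSpace p q m s h} (hx' : x' ∈ (chartAt (ℂ × ℝ) x).source) :
    param h (chartIdx x) (chartAt (ℂ × ℝ) x x') = x' := by
  rw [← chartAt_symm_eq ((chartAt (ℂ × ℝ) x).map_source hx'), (chartAt (ℂ × ℝ) x).left_inv hx']

theorem param_chartAt_self (x : LensSpace p q m s h) :
    param h (chartIdx x) (chartAt (ℂ × ℝ) x x) = x := param_chartAt (_root_.mem_chart_source _ x)

theorem paramDeriv_chartAt_self (x : LensSpace p q m s h) (v : ℂ × ℝ) :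
    paramDeriv h (chartIdx x) (chartAt (ℂ × ℝ) x x) v = v := by
  rw [← mfderiv_chartAt_symm (mem_chart_target _ x)]
  exact DFunLike.congr_fun (mfderiv_chartAt_symm_self x) v

/-- Tensors on the two solid tori that are compatible with the gluing maps define a tensor on the
lens space. -/
theorem eq_apply_paramDeriv {A : Fin 2 → ℂ × ℝ → ℂ × ℝ → ℂ × ℝ → ℝ}
    (hA : ∀ j y v w (n : ℤ), A j (y + (0, 2 * Real.pi * n)) v w = A j y v w)
    (hA' : ∀ j k, j ≠ k → ∀ ρ : ℝ × ℝ × ℝ, 0 < ρ.1 → ρ.1 < 1 → ∀ ν ξ,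
      A k (polar (glueAffine (twist q s k) m p (twist q s j) ρ))
        (polarDeriv (glueAffine (twist q s k) m p (twist q s j) ρ)
          (glueLinear (twist q s k) m p (twist q s j) ν))
        (polarDeriv (glueAffine (twist q s k) m p (twist q s j) ρ)
          (glueLinear (twist q s k) m p (twist q s j) ξ)) =
      A j (polar ρ) (polarDeriv ρ ν) (polarDeriv ρ ξ))
    {j : Fin 2} {y : ℂ × ℝ} (hy : ‖y.1‖ < 1) {x : LensSpace p q m s h} (hx : param h j y = x)
    (v w : ℂ × ℝ) :
    A (chartIdx x) (chartAt (ℂ × ℝ) x x) (paramDeriv h j y v) (paramDeriv h j y w) =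
      A j y v w := by
  have hid := paramDeriv_chartAt_self x
  rcases param_eq_param hy (norm_chartAt_self x) (hx.trans (param_chartAt_self x).symm) with
    ⟨h1, n, h2⟩ | ⟨hjk, ρ, n, h0, h1, h2, h3⟩
  · rw [← h1] at hid ⊢
    have h3 : ∀ v, paramDeriv h j y v = v := fun v => by
      rw [← paramDeriv_add_int j hy n, ← h2, hid]
    rw [h3, h3, h2, hA]
  · subst h2
    -- An overlap of different tori lies off both cores, so every tangent vector comes from
    -- cylindrical coordinates and `hA'` applies.
    obtain ⟨ν, rfl⟩ := polarDeriv_surjective h0.ne' v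
    obtain ⟨ξ, rfl⟩ := polarDeriv_surjective h0.ne' w
    rw [h3, paramDeriv_add_int _ (by
      rw [norm_glueAffine_polar _ _ _ _ h1]; linarith)] at hid
    rw [paramDeriv_polar hjk h0 h1, paramDeriv_polar hjk h0 h1, hid, hid, h3, hA, hA' _ _ hjk _ h0 h1]

/-! ### The linear flow on the lens space -/

variable {b : Fin 2 → ℝ}

/-- The angular speed in `θ` on the `j`-th solid torus of the linear flow whose angular speeds in
`z` on the two solid tori are `b 0` and `b 1`. -/
def angularSpeed (p q s : ℤ) (b : Fin 2 → ℝ) (j : Fin 2) : ℝ :=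
  (b (1 - j) - twist q s j * b j) / p

theorem one_sub_eq {j k : Fin 2} (hjk : j ≠ k) : 1 - j = k := by
  fin_cases j <;> fin_cases k <;> simp at hjk ⊢

theorem angularSpeed_eq {j k : Fin 2} (hjk : j ≠ k) :
    angularSpeed p q s b j = (b k - twist q s j * b j) / p := by
  rw [angularSpeed, one_sub_eq hjk]

/-- The linear flow on the lens space. -/
def flow (b : Fin 2 → ℝ) (t : ℝ) (x : LensSpace p q m s h) : LensSpace p q m s h :=
  param h (chartIdx x) (linearFlow (angularSpeed p q s b (chartIdx x)) (b (chartIdx x)) t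
    (chartAt (ℂ × ℝ) x x))

theorem linearFlow_add_int (a b t : ℝ) (y : ℂ × ℝ) (n : ℤ) :
    linearFlow a b t (y + (0, 2 * Real.pi * n)) =
      linearFlow a b t y + (0, 2 * Real.pi * n) := by
  simp only [linearFlow]
  refine Prod.ext (by simp) ?_
  simp only [Prod.snd_add]
  ring

theorem linearFlow_polar (a b t : ℝ) (ρ : ℝ × ℝ × ℝ) :
    linearFlow a b t (polar ρ) = polar (ρ + (0, a * t, b * t)) := by
  refine Prod.ext ?_ rfl
  simp only [linearFlow, polar, Prod.fst_add, Prod.snd_add, add_zero]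
  push_cast
  rw [add_mul, Complex.exp_add]
  ring

/-- The gluing matrix sends the velocity `(a j, b j)` to `(a k, b k)`. The `z`-component `h1` is the
definition of `angularSpeed`; the `θ`-component `h2` follows from the determinant condition. -/
theorem glueAffine_add (hp : p ≠ 0) (h : m * p + s * q = 1) {j k : Fin 2} (hjk : j ≠ k) (t : ℝ)
    (ρ : ℝ × ℝ × ℝ) :
    glueAffine (twist q s k) m p (twist q s j) (ρ + (0, angularSpeed p q s b j * t, b j * t)) =
      glueAffine (twist q s k) m p (twist q s j) ρ +
        (0, angularSpeed p q s b k * t, b k * t) := by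
  have hp' : (p : ℝ) ≠ 0 := by exact_mod_cast hp
  have h' : (m * p + twist q s j * twist q s k : ℝ) = 1 := by exact_mod_cast twist_mul_twist h hjk
  have h1 : (p : ℝ) * angularSpeed p q s b j + twist q s j * b j = b k := by
    rw [angularSpeed_eq hjk]; field_simp; ring
  have h2 : -(twist q s k : ℝ) * angularSpeed p q s b j + m * b j = angularSpeed p q s b k := by
    rw [angularSpeed_eq hjk, angularSpeed_eq hjk.symm]
    field_simp
    linear_combination b j * h'
  simp only [glueAffine, map_add, add_assoc]
  congr 2
  rw [glueLinear_apply]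
  refine Prod.ext (by simp) (Prod.ext ?_ ?_)
  · simp only; rw [← h2]; ring
  · simp only; rw [← h1]; ring

/-- The flow is defined through the preferred chart of each point. Commutation with translations of
`z` and with the gluing makes any parametrization equally valid, and the group law and smoothness
follow from this. -/
theorem flow_param (hp : p ≠ 0) (t : ℝ) (j : Fin 2) {y : ℂ × ℝ} (hy : ‖y.1‖ < 1) :
    flow b t (param h j y) =
      param h j (linearFlow (angularSpeed p q s b j) (b j) t y) := by
  unfold flow
  generalize hx : param h j y = x
  rcases param_eq_param hy (norm_chartAt_self x) (hx.trans (param_chartAt_self x).symm) with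
    ⟨h1, n, h2⟩ | ⟨hjk, ρ, n, h0, h1, h2, h3⟩
  · rw [← h1, h2, linearFlow_add_int, param_add_int]
  · rw [h3, linearFlow_add_int, param_add_int, h2, linearFlow_polar, linearFlow_polar,
      ← glueAffine_add hp h hjk, ← param_polar hjk] <;> simpa

theorem flow_zero (x : LensSpace p q m s h) : flow b 0 x = x := by
  unfold flow
  have : ∀ (a b : ℝ) (y : ℂ × ℝ), linearFlow a b 0 y = y := fun a b y => by simp [linearFlow]
  rw [this, param_chartAt_self]

theorem flow_add (hp : p ≠ 0) (t t' : ℝ) (x : LensSpace p q m s h) :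
    flow b (t + t') x = flow b t (flow b t' x) := by
  obtain ⟨j, y, hy, rfl⟩ := exists_param x
  rw [flow_param hp _ _ hy, flow_param hp _ _ hy, flow_param hp _ _ (by rwa [norm_linearFlow])]
  congr 1
  simp only [linearFlow]
  refine Prod.ext ?_ ?_
  · push_cast
    rw [mul_add, add_mul, Complex.exp_add, mul_assoc]
  · simp only; ring

theorem contMDiff_flow (hp : p ≠ 0) :
    ContMDiff (𝓘(ℝ, ℝ).prod 𝓘(ℝ, ℂ × ℝ)) 𝓘(ℝ, ℂ × ℝ) ∞
      (fun z : ℝ × LensSpace p q m s h => flow b z.1 z.2) := by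
  rintro ⟨t, x⟩
  set j := chartIdx x
  set a := angularSpeed p q s b j
  have h1 : ContMDiffAt (𝓘(ℝ, ℝ).prod 𝓘(ℝ, ℂ × ℝ)) 𝓘(ℝ, ℝ × ℂ × ℝ) ∞
      (fun z : ℝ × LensSpace p q m s h => (z.1, chartAt (ℂ × ℝ) x z.2)) (t, x) :=
    contMDiffAt_fst.prodMk_space ((contMDiffAt_chartAt_self x).comp (t, x) contMDiffAt_snd)
  have h2 : ContMDiffAt 𝓘(ℝ, ℝ × ℂ × ℝ) 𝓘(ℝ, ℂ × ℝ) ∞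
      (fun z : ℝ × ℂ × ℝ => linearFlow a (b j) z.1 z.2) (t, chartAt (ℂ × ℝ) x x) :=
    (contDiff_linearFlow a (b j)).contDiffAt.contMDiffAt
  have h3 : ContMDiffAt 𝓘(ℝ, ℂ × ℝ) 𝓘(ℝ, ℂ × ℝ) ∞ (param h j)
      (linearFlow a (b j) t (chartAt (ℂ × ℝ) x x)) :=
    contMDiffAt_param j (by rw [norm_linearFlow]; exact norm_chartAt_self x)
  have h4 := ContMDiffAt.comp (g := fun z : ℝ × ℂ × ℝ => linearFlow a (b j) z.1 z.2) (t, x) h2 h1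
  refine (ContMDiffAt.comp (g := param h j) (t, x) h3 h4).congr_of_eventuallyEq ?_
  have h5 : ∀ᶠ z : ℝ × LensSpace p q m s h in 𝓝 (t, x), z.2 ∈ (chartAt (ℂ × ℝ) x).source :=
    continuousAt_snd.preimage_mem_nhds
      ((chartAt (ℂ × ℝ) x).open_source.mem_nhds (_root_.mem_chart_source _ x))
  filter_upwards [h5] with z hz
  have h6 := flow_param (h := h) (b := b) hp z.1 j
    (norm_lt_of_mem_chartAt_target ((chartAt (ℂ × ℝ) x).map_source hz))
  rwa [param_chartAt hz] at h6

/-- The vector field generating `flow`. -/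
def field (b : Fin 2 → ℝ) (x : LensSpace p q m s h) : TangentSpace 𝓘(ℝ, ℂ × ℝ) x :=
  linearField (angularSpeed p q s b (chartIdx x)) (b (chartIdx x)) (chartAt (ℂ × ℝ) x x)

theorem hasMFDerivAt_flow (hp : p ≠ 0) (x : LensSpace p q m s h) (t : ℝ) :
    HasMFDerivAt 𝓘(ℝ, ℝ) 𝓘(ℝ, ℂ × ℝ) (fun t => flow b t x) t
      ((1 : ℝ →L[ℝ] ℝ).smulRight (field b (flow b t x))) := by
  set x' := flow b t x with hx'
  set j := chartIdx x' with hj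
  set a := angularSpeed p q s b j with ha
  set y := chartAt (ℂ × ℝ) x' x' with hy
  -- By the group law the curve is restarted at `x' = flow b t x`, so that it is differentiated in
  -- the chart in which `field` at `x'` is defined.
  have hcurve : (fun t => flow b t x) = fun t' => param h j (linearFlow a (b j) (t' - t) y) := by
    funext t'
    have h1 := flow_add (b := b) hp (t' - t) t x
    rw [sub_add_cancel, ← hx'] at h1
    rw [h1, flow]
  have hy0 : linearFlow a (b j) (t - t) y = y := by simp [linearFlow]
  have hd : HasDerivAt (fun t' => linearFlow a (b j) (t' - t) y) (linearField a (b j) y) t := by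
    have h1 := hasDerivAt_linearFlow a (b j) y
    rw [← sub_self t] at h1
    exact h1.comp_sub_const t t
  have hnorm : ‖(linearFlow a (b j) (t - t) y).1‖ < 1 := by
    rw [hy0]; exact norm_chartAt_self x'
  have h2 : HasMFDerivAt 𝓘(ℝ, ℝ) 𝓘(ℝ, ℂ × ℝ)
      (param h j ∘ fun t' => linearFlow a (b j) (t' - t) y) t _ :=
    (mdifferentiableAt_param (h := h) j hnorm).hasMFDerivAt.comp t hd.hasFDerivAt.hasMFDerivAt
  have h3 : mfderiv 𝓘(ℝ, ℂ × ℝ) 𝓘(ℝ, ℂ × ℝ) (param h j) (linearFlow a (b j) (t - t) y) =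
      ContinuousLinearMap.id ℝ (ℂ × ℝ) := by
    change paramDeriv h j (linearFlow a (b j) (t - t) y) = _
    rw [hy0]
    exact ContinuousLinearMap.ext fun v => paramDeriv_chartAt_self x' v
  rw [h3] at h2
  rw [hcurve]
  refine h2.congr_mfderiv ?_
  rfl

theorem isFlow_flow (hp : p ≠ 0) :
    IsFlow (field b) (flow b : ℝ → LensSpace p q m s h → LensSpace p q m s h) where
  contMDiff := contMDiff_flow hp
  zero := flow_zero
  isIntegralCurve x t := hasMFDerivAt_flow hp x t

theorem mfderiv_flow (hp : p ≠ 0) (t : ℝ) (j : Fin 2) {y : ℂ × ℝ} (hy : ‖y.1‖ < 1) (v : ℂ × ℝ) :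
    (mfderiv 𝓘(ℝ, ℂ × ℝ) 𝓘(ℝ, ℂ × ℝ) (flow b t) (param h j y) : ℂ × ℝ →L[ℝ] ℂ × ℝ)
        (paramDeriv h j y v) =
      paramDeriv h j (linearFlow (angularSpeed p q s b j) (b j) t y)
        (linearFlowDeriv (angularSpeed p q s b j) t v) := by
  set a := angularSpeed p q s b j
  have hd := hasFDerivAt_linearFlow a (b j) t y
  have h1 := mfderiv_param_comp (h := h) j hd.differentiableAt (by rwa [norm_linearFlow]) v
  rw [hd.fderiv] at h1
  rw [← h1]
  have h2 : flow b t ∘ param h j =ᶠ[𝓝 y] param h j ∘ linearFlow a (b j) t := by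
    filter_upwards [(isOpen_lt continuous_fst.norm continuous_const).mem_nhds hy] with y' hy'
    exact flow_param hp t j hy'
  have h3 : MDifferentiableAt 𝓘(ℝ, ℂ × ℝ) 𝓘(ℝ, ℂ × ℝ) (flow b t) (param h j y) := by
    have h4 : ContMDiffAt 𝓘(ℝ, ℂ × ℝ) 𝓘(ℝ, ℂ × ℝ) ∞ (flow b t) (param h j y) :=
      ((contMDiff_flow (b := b) hp).comp
        (contMDiff_const.prodMk contMDiff_id)).contMDiffAt
    exact h4.mdifferentiableAt (by simp)
  have h5 := mfderiv_comp y h3 (mdifferentiableAt_param (h := h) j hy)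
  have h6 := h2.mfderiv_eq (I := 𝓘(ℝ, ℂ × ℝ)) (I' := 𝓘(ℝ, ℂ × ℝ))
  rw [h5] at h6
  exact DFunLike.congr_fun h6 v

/-! ### The contact form on the lens space and its Reeb flow -/

/-- The contact form on the `j`-th solid torus. -/
def localForm (p q s : ℤ) (b : Fin 2 → ℝ) (j : Fin 2) : ℂ × ℝ → ℂ × ℝ →L[ℝ] ℝ :=
  SolidTorus.contactForm (angularSpeed p q s b j) (b j) (p / (2 * b (1 - j)))

/-- The contact form on the lens space. -/
def contactForm (b : Fin 2 → ℝ) : OneForm (ℂ × ℝ) (LensSpace p q m s h) := fun x =>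
  localForm p q s b (chartIdx x) (chartAt (ℂ × ℝ) x x)

theorem contactForm_param (hp : p ≠ 0) (hb : ∀ j, b j ≠ 0) (j : Fin 2) {y : ℂ × ℝ}
    (hy : ‖y.1‖ < 1) (v : ℂ × ℝ) :
    contactForm b (param h j y) (paramDeriv h j y v) = localForm p q s b j y v := by
  -- A 1-form is fed to the descent lemma as a two-argument tensor that ignores its second argument.
  refine eq_apply_paramDeriv (A := fun j y v _ => localForm p q s b j y v) ?_ ?_ hy rfl v v
  · intro j y v w n
    simp [localForm, SolidTorus.contactForm, rsq, rsqdθ]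
  · intro j k hjk ρ h0 h1 ν ξ
    simp only [localForm]
    rw [angularSpeed_eq hjk, angularSpeed_eq hjk.symm, one_sub_eq hjk, one_sub_eq hjk.symm]
    exact contactForm_glue (twist_mul_twist h hjk) (hb j) (hb k) hp ρ ν

theorem inChart_contactForm (hp : p ≠ 0) (hb : ∀ j, b j ≠ 0) (x : LensSpace p q m s h) :
    (contactForm b : OneForm (ℂ × ℝ) (LensSpace p q m s h)).inChart x =ᶠ[𝓝 (chartAt (ℂ × ℝ) x x)] localForm p q s b (chartIdx x) := by
  filter_upwards [(chartAt (ℂ × ℝ) x).open_target.mem_nhds (mem_chart_target _ x)] with y hy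
  refine ContinuousLinearMap.ext fun v => ?_
  rw [← contactForm_param (h := h) hp hb _ (norm_lt_of_mem_chartAt_target hy), OneForm.inChart,
    mfderiv_chartAt_symm hy]
  exact OneForm.congr_point (E := ℂ × ℝ) (contactForm b) (chartAt_symm_eq hy) _

theorem contDiff_localForm (j : Fin 2) : ContDiff ℝ ∞ (localForm p q s b j) :=
  contDiff_contactForm _ _ _

theorem contDiffAt_inChart_contactForm (hp : p ≠ 0) (hb : ∀ j, b j ≠ 0)
    (x : LensSpace p q m s h) :
    ContDiffAt ℝ ∞ ((contactForm b).inChart x) (chartAt (ℂ × ℝ) x x) :=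
  (contDiff_localForm _).contDiffAt.congr_of_eventuallyEq (inChart_contactForm hp hb x)

theorem contactForm_d_param (hp : p ≠ 0) (hb : ∀ j, b j ≠ 0) (j : Fin 2) {y : ℂ × ℝ}
    (hy : ‖y.1‖ < 1) (v w : ℂ × ℝ) :
    (contactForm b).d (param h j y) (paramDeriv h j y v) (paramDeriv h j y w) =
      contactFormD (angularSpeed p q s b j) (b j) (p / (2 * b (1 - j))) y v w := by
  have ho := (isOpen_lt continuous_fst.norm continuous_const).mem_nhds hy
  refine OneForm.d_mfderiv (contactForm b) (φ := param h j) ?_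
    ((contDiffAt_inChart_contactForm hp hb _).differentiableAt (by simp)) ?_ v w
  · filter_upwards [ho] with y' hy' using contMDiffAt_param j hy'
  · filter_upwards [ho] with y' hy' v using (contactForm_param hp hb j hy' v).symm

theorem isPositiveContactForm_contactForm (hp : 0 < p) (hb : ∀ j, 0 < b j) :
    IsPositiveContactForm (contactForm b : OneForm (ℂ × ℝ) (LensSpace p q m s h)) := by
  have hb' : ∀ j, b j ≠ 0 := fun j => (hb j).ne'
  refine ⟨OneForm.isSmooth_of_inChart _ (contDiffAt_inChart_contactForm hp.ne' hb'),
    fun j y hy => ?_⟩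
  have hc : (0 : ℝ) < p / (2 * b (1 - j)) :=
    div_pos (by exact_mod_cast hp) (mul_pos two_pos (hb _))
  refine (contactForm_wedge_pos (a := angularSpeed p q s b j) (hb j) hc hy).trans_eq ?_
  change _ = (contactForm b).wedgeD (param h j y) (paramDeriv h j y (1, 0))
    (paramDeriv h j y (Complex.I, 0)) (paramDeriv h j y (0, 1))
  have hα := contactForm_param (h := h) hp.ne' hb' j hy
  have hd := contactForm_d_param (h := h) hp.ne' hb' j hy
  exact (congrArg₂ (· + ·) (congrArg₂ (· + ·) (congrArg₂ (· * ·) (hα _) (hd _ _))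
    (congrArg₂ (· * ·) (hα _) (hd _ _))) (congrArg₂ (· * ·) (hα _) (hd _ _))).symm

theorem isReebField_field (hp : p ≠ 0) (hb : ∀ j, b j ≠ 0) :
    (contactForm b : OneForm (ℂ × ℝ) (LensSpace p q m s h)).IsReebField (field b) := by
  intro x
  refine ⟨contactForm_linearField (hb _) _, fun v => ?_⟩
  refine ((contactForm b).d_eq x _ _).trans ?_
  rw [(inChart_contactForm hp hb x).fderiv_eq]
  exact contactFormD_linearField (hb _) _ _

theorem isReebFlow_flow (hp : p ≠ 0) (hb : ∀ j, b j ≠ 0) :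
    (contactForm b : OneForm (ℂ × ℝ) (LensSpace p q m s h)).IsReebFlow (flow b) :=
  ⟨field b, isReebField_field hp hb, isFlow_flow hp⟩

/-! ### The metric on the lens space preserved by the flow -/

/-- The toric metric on the `j`-th solid torus. -/
def localMetric (p q m s : ℤ) (j : Fin 2) : ℂ × ℝ → ℂ × ℝ →L[ℝ] ℂ × ℝ →L[ℝ] ℝ :=
  SolidTorus.metric (twist q s (1 - j)) m p (twist q s j)

/-- The field of inner products of the toric metric. -/
def metricInner (x : LensSpace p q m s h) :
    TangentSpace 𝓘(ℝ, ℂ × ℝ) x →L[ℝ] TangentSpace 𝓘(ℝ, ℂ × ℝ) x →L[ℝ] ℝ :=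
  localMetric p q m s (chartIdx x) (chartAt (ℂ × ℝ) x x)

theorem metricInner_param (j : Fin 2) {y : ℂ × ℝ} (hy : ‖y.1‖ < 1) {x : LensSpace p q m s h}
    (hx : param h j y = x) (v w : ℂ × ℝ) :
    metricInner x (paramDeriv h j y v) (paramDeriv h j y w) = localMetric p q m s j y v w := by
  refine eq_apply_paramDeriv (A := fun j y v w => localMetric p q m s j y v w) ?_ ?_ hy hx v w
  · intro j y v w n
    simp [localMetric, metric_apply, gluedMetric_apply, rsq, rsqdθ_apply, rdr_apply]
  · intro j k hjk ρ h0 h1 ν ξ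
    simp only [localMetric]
    rw [one_sub_eq hjk, one_sub_eq hjk.symm]
    exact metric_glue (twist_mul_twist h hjk) h0 h1 ν ξ

theorem metricInner_pos (x : LensSpace p q m s h) (v : ℂ × ℝ) (hv : v ≠ 0) :
    0 < metricInner x v v := by
  have h1 : chartIdx x ≠ 1 - chartIdx x := by
    generalize chartIdx x = j
    fin_cases j <;> simp
  refine metric_pos ?_ (norm_chartAt_self x) hv
  have := twist_mul_twist h h1
  linarith

/-- A toric metric on the lens space. -/
def toricMetric (h : m * p + s * q = 1) : Bundle.ContMDiffRiemannianMetric 𝓘(ℝ, ℂ × ℝ) ∞ (ℂ × ℝ)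
    (fun x : LensSpace p q m s h ↦ TangentSpace 𝓘(ℝ, ℂ × ℝ) x) where
  inner := metricInner
  symm x v w := metric_symm _ _ _ _ _ _ _
  pos x v hv := metricInner_pos x v hv
  isVonNBounded x := isVonNBounded_of_posDef (E := ℂ × ℝ) (metricInner x) (metricInner_pos x)
  contMDiff := by
    refine contMDiff_bilinear_of_chart metricInner (fun x => localMetric p q m s (chartIdx x))
      (fun x => (contDiff_metric _ _ _ _).contDiffAt) fun x y hy v w => ?_
    rw [mfderiv_chartAt_symm hy]
    exact metricInner_param _ (norm_lt_of_mem_chartAt_target hy) (chartAt_symm_eq hy).symm v w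

theorem isKillingFlow_flow (hp : p ≠ 0) :
    IsKillingFlow (E := ℂ × ℝ) (M := LensSpace p q m s h) (flow b) (toricMetric h) := by
  intro x v w
  set j := chartIdx x
  set y := chartAt (ℂ × ℝ) x x
  have hy : ‖y.1‖ < 1 := norm_chartAt_self x
  have hx : param h j y = x := param_chartAt_self x
  -- The flow acts by isometries: the function to be differentiated is constant in `t`.
  have hconst : ∀ t, (toricMetric h).inner (flow b t x)
      (mfderiv 𝓘(ℝ, ℂ × ℝ) 𝓘(ℝ, ℂ × ℝ) (flow b t) x v)
      (mfderiv 𝓘(ℝ, ℂ × ℝ) 𝓘(ℝ, ℂ × ℝ) (flow b t) x w) = metricInner x v w := by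
    intro t
    have h1 : ∀ v : ℂ × ℝ, (mfderiv 𝓘(ℝ, ℂ × ℝ) 𝓘(ℝ, ℂ × ℝ) (flow b t) x :
        ℂ × ℝ →L[ℝ] ℂ × ℝ) v = paramDeriv h j (linearFlow (angularSpeed p q s b j) (b j) t y)
          (linearFlowDeriv (angularSpeed p q s b j) t v) := by
      intro v
      rw [← mfderiv_flow hp t j hy v, paramDeriv_chartAt_self, hx]
    change metricInner (flow b t x) ((mfderiv 𝓘(ℝ, ℂ × ℝ) 𝓘(ℝ, ℂ × ℝ) (flow b t) x :
        ℂ × ℝ →L[ℝ] ℂ × ℝ) v) ((mfderiv 𝓘(ℝ, ℂ × ℝ) 𝓘(ℝ, ℂ × ℝ) (flow b t) x :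
        ℂ × ℝ →L[ℝ] ℂ × ℝ) w) = _
    refine (congrArg₂ (fun u u' : ℂ × ℝ => metricInner (flow b t x) u u') (h1 v) (h1 w)).trans ?_
    refine (metricInner_param j (by rwa [norm_linearFlow]) ?_ _ _).trans ?_
    · rw [← flow_param hp t j hy, hx]
    exact metric_linearFlow _ _ _ _ _ _ _ _ _ _
  simp only [hconst]
  exact hasDerivAt_const _ _

theorem isKContact_contactForm (hp : p ≠ 0) (hb : ∀ j, b j ≠ 0) :
    (contactForm b : OneForm (ℂ × ℝ) (LensSpace p q m s h)).IsKContact :=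
  ⟨flow b, isReebFlow_flow hp hb, toricMetric h, isKillingFlow_flow hp⟩

/-! ### The cores: periods and rotation numbers -/

/-- The core of the `j`-th solid torus. -/
def core (h : m * p + s * q = 1) (j : Fin 2) : Set (LensSpace p q m s h) :=
  range fun z : ℝ => param h j (0, z)

theorem flow_core (hp : p ≠ 0) (t : ℝ) (j : Fin 2) (z : ℝ) :
    flow b t (param h j (0, z)) = param h j (0, z + b j * t) := by
  rw [flow_param hp t j (by simp)]
  simp [linearFlow]

theorem param_eq_param_self {j : Fin 2} {y y' : ℂ × ℝ} (hy : ‖y.1‖ < 1) (hy' : ‖y'.1‖ < 1)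
    (hyy' : param h j y = param h j y') : ∃ n : ℤ, y' = y + (0, 2 * Real.pi * n) := by
  rcases param_eq_param hy hy' hyy' with ⟨-, h1⟩ | ⟨h1, -⟩
  · exact h1
  · exact absurd rfl h1

theorem flowOrbit_core (hp : p ≠ 0) {j : Fin 2} (hb : b j ≠ 0) (z : ℝ) :
    flowOrbit (flow b) (param h j (0, z)) = core h j := by
  ext x
  constructor
  · rintro ⟨t, rfl⟩
    exact ⟨z + b j * t, (flow_core hp t j z).symm⟩
  · rintro ⟨z', rfl⟩
    refine ⟨(z' - z) / b j, ?_⟩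
    change flow b _ _ = _
    rw [flow_core hp, mul_div_cancel₀ _ hb, add_sub_cancel]

theorem isPeriodicOrbit_core (hp : p ≠ 0) {j : Fin 2} (hb : 0 < b j) :
    IsPeriodicOrbit (flow b) (core h j) (2 * Real.pi / b j) := by
  have hpi := Real.pi_pos
  refine ⟨⟨param h j (0, 0), (flowOrbit_core hp hb.ne' 0).symm⟩, ?_⟩
  rintro _ ⟨z, rfl⟩
  refine ⟨⟨by positivity, ?_⟩, ?_⟩
  · rw [flow_core hp, mul_div_cancel₀ _ hb.ne']
    simpa using param_add_int (h := h) j (0, z) 1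
  · rintro t ⟨ht, hfix⟩
    rw [flow_core hp] at hfix
    obtain ⟨n, hn⟩ := param_eq_param_self (by simp) (by simp) hfix.symm
    have h1 : b j * t = 2 * Real.pi * n := by simpa using congrArg Prod.snd hn
    have h2 : (0 : ℝ) < n := by
      have : 0 < 2 * Real.pi * n := h1 ▸ mul_pos hb ht
      exact pos_of_mul_pos_right this (by positivity)
    have h3 : (1 : ℝ) ≤ n := by exact_mod_cast h2
    rw [div_le_iff₀ hb, mul_comm t, h1]
    nlinarith

theorem core_ne_core (h : m * p + s * q = 1) {j k : Fin 2} (hjk : j ≠ k) :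
    core h j ≠ core h k := by
  intro he
  have h1 : param h j (0, 0) ∈ core h k := he ▸ ⟨0, rfl⟩
  obtain ⟨z, hz⟩ := h1
  rcases param_eq_param (by simp) (by simp) hz with ⟨h1, -⟩ | ⟨-, ρ, n, h0, h1, h2, -⟩
  · exact hjk h1.symm
  · have := norm_polar h0.le
    rw [← h2] at this
    simp only [norm_zero] at this
    linarith

theorem tangentBundle_mk_eq {x x' : LensSpace p q m s h} {v v' : ℂ × ℝ} (hx : x = x')
    (hv : v = v') : (⟨x, v⟩ : TangentBundle 𝓘(ℝ, ℂ × ℝ) (LensSpace p q m s h)) = ⟨x', v'⟩ := by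
  subst hx hv; rfl

/-- In time `2π / b j` the coordinate `z` advances by exactly `2π`, and the return map on the
`w`-plane, which is the contact plane, is multiplication by `e^{i a τ}`. The integer `n` absorbs the
ambiguity of `φ` modulo `1`. -/
theorem hasRotationNumber_core (hp : 0 < p) (hb : ∀ j, 0 < b j) (j : Fin 2) {φ : ℝ} {n : ℤ}
    (hφ : angularSpeed p q s b j * (2 * Real.pi / b j) = 2 * Real.pi * φ + 2 * Real.pi * n) :
    (contactForm b).HasRotationNumber (flow b) (core h j) (2 * Real.pi / b j) φ := by
  have hb' : ∀ j, b j ≠ 0 := fun j => (hb j).ne'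
  set τ := 2 * Real.pi / b j with hτ
  rintro _ ⟨z, rfl⟩
  have hy : ‖((0, z) : ℂ × ℝ).1‖ < 1 := by simp
  have hc : (0 : ℝ) < p / (2 * b (1 - j)) :=
    div_pos (by exact_mod_cast hp) (mul_pos two_pos (hb _))
  have hα : ∀ v : ℂ, contactForm b (param h j (0, z)) (paramDeriv h j (0, z) (v, 0)) = 0 :=
    fun v => (contactForm_param hp.ne' hb' j hy _).trans (contactForm_core _ _ _ _ _)
  have hfix : linearFlow (angularSpeed p q s b j) (b j) τ (0, z) =
      (0, z) + (0, 2 * Real.pi * (1 : ℤ)) := by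
    rw [hτ, linearFlow, mul_div_cancel₀ _ (hb' j)]
    simp
  have hexp : Complex.exp (angularSpeed p q s b j * τ * Complex.I) =
      Real.cos (2 * Real.pi * φ) + Real.sin (2 * Real.pi * φ) * Complex.I := by
    have h1 : (angularSpeed p q s b j * τ * Complex.I : ℂ) =
        ((2 * Real.pi * φ : ℝ) : ℂ) * Complex.I + n * (2 * Real.pi * Complex.I) := by
      have : (angularSpeed p q s b j * τ : ℂ) = ((angularSpeed p q s b j * τ : ℝ) : ℂ) := by
        push_cast; rfl
      rw [this, hφ]; push_cast; ring
    rw [h1, Complex.exp_add, Complex.exp_int_mul_two_pi_mul_I, mul_one, Complex.exp_mul_I]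
    push_cast; rfl
  have hmap : ∀ v : ℂ, (mfderiv 𝓘(ℝ, ℂ × ℝ) 𝓘(ℝ, ℂ × ℝ) (flow b τ) (param h j (0, z)) :
      ℂ × ℝ →L[ℝ] ℂ × ℝ) (paramDeriv h j (0, z) (v, 0)) = paramDeriv h j (0, z)
        ((Real.cos (2 * Real.pi * φ) + Real.sin (2 * Real.pi * φ) * Complex.I) * v, 0) := by
    intro v
    rw [mfderiv_flow hp.ne' τ j hy, hfix, paramDeriv_add_int j hy, linearFlowDeriv_apply, hexp]
  have hx : flow b τ (param h j (0, z)) = param h j (0, z) := by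
    rw [flow_param hp.ne' τ j hy, hfix, param_add_int]
  refine ⟨paramDeriv h j (0, z) (1, 0), paramDeriv h j (0, z) (Complex.I, 0), hα _, hα _, ?_,
    tangentBundle_mk_eq hx ((hmap _).trans ?_), tangentBundle_mk_eq hx ((hmap _).trans ?_)⟩
  · exact (contactFormD_core_pos hc z).trans_eq (contactForm_d_param hp.ne' hb' j hy _ _).symm
  · refine Eq.trans ?_ ((map_add (paramDeriv h j (0, z)) _ _).trans (congrArg₂ (· + ·)
      (map_smul (paramDeriv h j (0, z)) (Real.cos (2 * Real.pi * φ)) _)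
      (map_smul (paramDeriv h j (0, z)) (Real.sin (2 * Real.pi * φ)) _)))
    congr 1
    refine Prod.ext ?_ ?_ <;> simp
  · refine Eq.trans ?_ ((map_add (paramDeriv h j (0, z)) _ _).trans (congrArg₂ (· + ·)
      (map_smul (paramDeriv h j (0, z)) (-Real.sin (2 * Real.pi * φ)) _)
      (map_smul (paramDeriv h j (0, z)) (Real.cos (2 * Real.pi * φ)) _)))
    congr 1
    refine Prod.ext ?_ ?_
    · simp only [Prod.fst_add, Prod.smul_fst, Complex.real_smul]
      push_cast
      linear_combination Complex.sin (2 * Real.pi * φ) * Complex.I_mul_I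
    · simp

/-! ### Closed orbits off the cores and rationality -/

theorem mul_angularSpeed (hp : p ≠ 0) {j k : Fin 2} (hjk : j ≠ k) :
    p * angularSpeed p q s b j = b k - twist q s j * b j := by
  have : (p : ℝ) ≠ 0 := by exact_mod_cast hp
  rw [angularSpeed_eq hjk, mul_div_cancel₀ _ this]

theorem isQuasiRegular_flow (hp : 0 < p) (hb : ∀ j, 0 < b j) (hr : ∃ r : ℚ, b 1 / b 0 = r) :
    IsQuasiRegular (flow b : ℝ → LensSpace p q m s h → LensSpace p q m s h) := by
  have hpi := Real.pi_pos
  have hp' : (0 : ℝ) < p := by exact_mod_cast hp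
  obtain ⟨r, hr⟩ := hr
  have hr0 : 0 < r := by
    have : (0 : ℝ) < r := hr ▸ div_pos (hb 1) (hb 0)
    exact_mod_cast this
  -- With this `T`, `b 0 * T` and `b 1 * T` are `2πp` times the denominator and the numerator of
  -- `r`. The extra factor `p` cancels the denominator of the angular speeds, so every point returns
  -- at time `T`.
  set T := 2 * Real.pi * p * r.den / b 0 with hT
  have hT0 : 0 < T := by
    have := hb 0
    have := r.den_pos
    positivity
  have hden : (r.den : ℝ) ≠ 0 := by exact_mod_cast r.den_pos.ne'
  have hT1 : ∃ n : Fin 2 → ℤ, ∀ j, b j * T = 2 * Real.pi * p * n j := by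
    refine ⟨![r.den, r.num], fun j => ?_⟩
    fin_cases j
    · simp only [Fin.zero_eta, Matrix.cons_val_zero, Int.cast_natCast]
      rw [hT, mul_div_cancel₀ _ (hb 0).ne']
    · simp only [Fin.mk_one, Matrix.cons_val_one, Matrix.cons_val_fin_one]
      have h1 : b 1 = r * b 0 := by rw [← hr, div_mul_cancel₀ _ (hb 0).ne']
      have h2 : (r : ℝ) * r.den = r.num := by exact_mod_cast Rat.mul_den_eq_num r
      have h0 := (hb 0).ne'
      rw [h1, hT]
      field_simp
      linear_combination h2
  obtain ⟨n, hn⟩ := hT1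
  intro x
  refine ⟨x, rfl, T, hT0, ?_⟩
  obtain ⟨j, y, hy, rfl⟩ := exists_param x
  have hjk : j ≠ 1 - j := by fin_cases j <;> simp
  rw [flow_param hp.ne' T j hy]
  have h1 : angularSpeed p q s b j * T = 2 * Real.pi * (n (1 - j) - twist q s j * n j : ℤ) := by
    have h2 := mul_angularSpeed (q := q) (s := s) (b := b) hp.ne' hjk
    refine mul_left_cancel₀ hp'.ne' ?_
    push_cast
    linear_combination T * h2 + hn (1 - j) - twist q s j * hn j
  have h3 : linearFlow (angularSpeed p q s b j) (b j) T y =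
      y + (0, 2 * Real.pi * (p * n j : ℤ)) := by
    have h4 : Complex.exp (angularSpeed p q s b j * T * Complex.I) = 1 := by
      rw [Complex.exp_eq_one_iff]
      refine ⟨n (1 - j) - twist q s j * n j, ?_⟩
      rw [show (angularSpeed p q s b j * T : ℂ) = ((angularSpeed p q s b j * T : ℝ) : ℂ) by
        push_cast; rfl, h1]
      push_cast; ring
    rw [linearFlow, h4, hn]
    refine Prod.ext (by simp) ?_
    simp only [Prod.snd_add]
    push_cast; ring
  rw [h3, param_add_int]

/-- Since `w ≠ 0`, a return forces the rotation in `w` to be trivial as well as `z` to advance by a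
multiple of `2π`. Both frequencies times `t` then lie in `2πℤ`. -/
theorem exists_rat_of_flow_eq (hp : p ≠ 0) (hb : ∀ j, 0 < b j) {j : Fin 2} {y : ℂ × ℝ}
    (hy : ‖y.1‖ < 1) (hy0 : y.1 ≠ 0) {t : ℝ} (ht : 0 < t)
    (hfix : flow b t (param h j y) = param h j y) : ∃ r : ℚ, b 1 / b 0 = r := by
  have hpi := Real.pi_pos
  have hjk : j ≠ 1 - j := by fin_cases j <;> simp
  rw [flow_param hp t j hy] at hfix
  obtain ⟨n, hn⟩ := param_eq_param_self hy (by rwa [norm_linearFlow]) hfix.symm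
  have h1 : b j * t = 2 * Real.pi * n := by
    have := congrArg Prod.snd hn
    simp only [linearFlow, Prod.snd_add] at this
    linarith
  have h2 : Complex.exp (angularSpeed p q s b j * t * Complex.I) = 1 := by
    have := congrArg Prod.fst hn
    simp only [linearFlow, Prod.fst_add, add_zero] at this
    exact mul_right_cancel₀ hy0 (this.trans (one_mul _).symm)
  obtain ⟨l, hl⟩ := Complex.exp_eq_one_iff.1 h2
  have h3 : angularSpeed p q s b j * t = 2 * Real.pi * l := by
    have h4 : (angularSpeed p q s b j * t : ℂ) = l * (2 * Real.pi) :=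
      mul_right_cancel₀ Complex.I_ne_zero (by rw [hl]; ring)
    have h5 : ((angularSpeed p q s b j * t : ℝ) : ℂ) = ((l * (2 * Real.pi) : ℝ) : ℂ) := by
      push_cast; exact h4
    rw [Complex.ofReal_injective h5]; ring
  -- The other frequency is an integral combination of the two in hand: `b (1 - j) = p * a j + twist
  -- q s j * b j`.
  have h6 : b (1 - j) * t = 2 * Real.pi * (p * l + twist q s j * n : ℤ) := by
    have h7 := mul_angularSpeed (q := q) (s := s) (b := b) hp hjk
    push_cast
    linear_combination (-t) * h7 + p * h3 + twist q s j * h1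
  have key : ∀ k : ℤ × ℤ, b 0 * t = 2 * Real.pi * k.1 → b 1 * t = 2 * Real.pi * k.2 →
      ∃ r : ℚ, b 1 / b 0 = r := by
    rintro ⟨k, l⟩ hk hl
    refine ⟨l / k, ?_⟩
    have hb0 := (hb 0).ne'
    have hk0 : (k : ℝ) ≠ 0 := by
      rintro h0
      rw [h0, mul_zero] at hk
      exact (mul_pos (hb 0) ht).ne' hk
    push_cast
    rw [div_eq_div_iff hb0 hk0]
    have : (2 * Real.pi * t) * (b 1 * k) = (2 * Real.pi * t) * (l * b 0) := by
      linear_combination (2 * Real.pi * k) * hl - (2 * Real.pi * l) * hk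
    exact mul_left_cancel₀ (by positivity) this
  fin_cases j
  · exact key (_, _) h1 h6
  · exact key (_, _) h6 h1

/-- A periodic orbit comes with a return at some base point; commuting the flow maps carries that
return to every point of the orbit. -/
theorem flow_eq_of_flowOrbit_mem (hp : p ≠ 0) {x : LensSpace p q m s h}
    (hx : flowOrbit (flow b) x ∈ periodicOrbits (flow b)) : ∃ t, 0 < t ∧ flow b t x = x := by
  obtain ⟨x', hxx', t, ht, hfix⟩ := hx
  have h1 : x ∈ flowOrbit (flow b) x' := hxx' ▸ ⟨0, flow_zero x⟩
  obtain ⟨u, hu⟩ := h1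
  refine ⟨t, ht, ?_⟩
  change flow b u x' = x at hu
  rw [← hu, ← flow_add hp, add_comm, flow_add hp, hfix]

theorem isIrregular_flow (hp : p ≠ 0) (hb : ∀ j, 0 < b j) (hr : ¬∃ r : ℚ, b 1 / b 0 = r) :
    IsIrregular (flow b : ℝ → LensSpace p q m s h → LensSpace p q m s h) := by
  have hy : ‖((1 / 2, 0) : ℂ × ℝ).1‖ < 1 := by norm_num
  -- Any point off the cores would serve.
  refine ⟨param h 0 (1 / 2, 0), fun hx => hr ?_⟩
  obtain ⟨t, ht, hfix⟩ := flow_eq_of_flowOrbit_mem hp hx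
  exact exists_rat_of_flow_eq hp hb hy (by norm_num) ht hfix

theorem periodicOrbits_flow (hp : p ≠ 0) (hb : ∀ j, 0 < b j) (hr : ¬∃ r : ℚ, b 1 / b 0 = r) :
    periodicOrbits (flow b : ℝ → LensSpace p q m s h → LensSpace p q m s h) =
      {core h 0, core h 1} := by
  have hcore : ∀ j, core h j ∈ periodicOrbits (flow b) := fun j => by
    have h1 := isPeriodicOrbit_core (h := h) hp (hb j)
    refine ⟨param h j (0, 0), (flowOrbit_core hp (hb j).ne' 0).symm, _,
      (h1.isLeast _ ⟨0, rfl⟩).1⟩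
  refine subset_antisymm ?_ ?_
  · rintro _ ⟨x, rfl, t, ht, hfix⟩
    obtain ⟨j, ⟨w, z⟩, hy, rfl⟩ := exists_param x
    have hw : w = 0 := by
      by_contra hw
      exact hr (exists_rat_of_flow_eq hp hb hy hw ht hfix)
    subst hw
    rw [flowOrbit_core hp (hb j).ne']
    fin_cases j <;> simp
  · rintro _ (rfl | rfl)
    exacts [hcore 0, hcore 1]

end LensSpace
end

/-! ### Choice of the frequencies and conclusion -/

theorem mainTheorem6 (p q m s : ℤ) (hp : 0 < p) (h : m * p + s * q = 1)
    (τ₀ τ₁ : ℝ) (hτ₀ : 0 < τ₀) (hτ₁ : 0 < τ₁) :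
    ∃ α : OneForm (ℂ × ℝ) (LensSpace p q m s h),
      LensSpace.IsPositiveContactForm α ∧ α.IsKContact ∧
      ∃ Φ : ℝ → LensSpace p q m s h → LensSpace p q m s h, α.IsReebFlow Φ ∧
      ∃ ℓ₀ ℓ₁ : Set (LensSpace p q m s h), ℓ₀ ≠ ℓ₁ ∧
        IsPeriodicOrbit Φ ℓ₀ τ₀ ∧ IsPeriodicOrbit Φ ℓ₁ τ₁ ∧
        α.HasRotationNumber Φ ℓ₀ τ₀ ((τ₀ / τ₁ - q) / p) ∧
        (∀ s' : ℤ, s' * q ≡ 1 [ZMOD p] →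
          α.HasRotationNumber Φ ℓ₁ τ₁ ((τ₁ / τ₀ - s') / p)) ∧
        ((∃ r : ℚ, τ₀ / τ₁ = r) → IsQuasiRegular Φ) ∧
        (Irrational (τ₀ / τ₁) → IsIrregular Φ ∧ periodicOrbits Φ = {ℓ₀, ℓ₁}) := by
  have hpi := Real.pi_pos
  have hp' : (p : ℝ) ≠ 0 := by exact_mod_cast hp.ne'
  set b : Fin 2 → ℝ := ![2 * Real.pi / τ₀, 2 * Real.pi / τ₁] with hbdef
  have hb0 : b 0 = 2 * Real.pi / τ₀ := rfl
  have hb1 : b 1 = 2 * Real.pi / τ₁ := rfl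
  have hb : ∀ j, 0 < b j := fun j => by
    fin_cases j
    · exact div_pos (by positivity) hτ₀
    · exact div_pos (by positivity) hτ₁
  have ht0 : 2 * Real.pi / b 0 = τ₀ := by rw [hb0]; field_simp
  have ht1 : 2 * Real.pi / b 1 = τ₁ := by rw [hb1]; field_simp
  have hratio : b 1 / b 0 = τ₀ / τ₁ := by rw [hb0, hb1]; field_simp
  have p0 := LensSpace.isPeriodicOrbit_core (h := h) hp.ne' (hb 0)
  have p1 := LensSpace.isPeriodicOrbit_core (h := h) hp.ne' (hb 1)
  have r0 : ∀ φ n, _ → _ := fun φ n =>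
    LensSpace.hasRotationNumber_core (h := h) hp hb 0 (φ := φ) (n := n)
  have r1 : ∀ φ n, _ → _ := fun φ n =>
    LensSpace.hasRotationNumber_core (h := h) hp hb 1 (φ := φ) (n := n)
  rw [ht0] at p0 r0
  rw [ht1] at p1 r1
  refine ⟨LensSpace.contactForm b, LensSpace.isPositiveContactForm_contactForm hp hb,
    LensSpace.isKContact_contactForm hp.ne' fun j => (hb j).ne', LensSpace.flow b,
    LensSpace.isReebFlow_flow hp.ne' fun j => (hb j).ne', LensSpace.core h 0, LensSpace.core h 1,
    LensSpace.core_ne_core h (by simp), p0, p1, r0 _ 0 ?_, fun s' hs' => ?_, fun hr => ?_,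
    fun hr => ?_⟩
  · rw [LensSpace.angularSpeed_eq (k := 1) (by simp), hb0, hb1]
    simp only [LensSpace.twist, zero_ne_one, if_false, Int.cast_zero]
    field_simp
    ring
  · obtain ⟨c, hc⟩ := hs'.dvd
    -- Both `s` and `s'` invert `q` modulo `p`, so replacing one by the other shifts the rotation
    -- number by an integer. This integer is `(s' - s) / p`, computed from `m p + s q = 1` and `1 -
    -- s' q = p c`.
    refine r1 _ (s' * m - s * c) ?_
    have h1 : (s' - s : ℝ) = p * (s' * m - s * c) := by
      have : s' - s = p * (s' * m - s * c) := by linear_combination -s' * h - s * hc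
      exact_mod_cast this
    rw [LensSpace.angularSpeed_eq (k := 0) (by simp), hb0, hb1]
    simp only [LensSpace.twist, if_true]
    push_cast
    field_simp
    linear_combination τ₀ * h1
  · exact LensSpace.isQuasiRegular_flow hp hb (by rwa [hratio])
  · have hr' : ¬∃ r : ℚ, b 1 / b 0 = r := by
      rw [hratio]
      rintro ⟨r, hr2⟩
      exact hr ⟨r, hr2.symm⟩
    exact ⟨LensSpace.isIrregular_flow hp.ne' hb hr', LensSpace.periodicOrbits_flow hp.ne' hb hr'⟩
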